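/- Let $\Bbbk$ be an algebraically closed field of characteristic zero; all algebras are associative unital $\Bbbk$-algebras. Let $G$ be a finite abelian group, $\theta\in\mathbb N$, $g_1,\dots,g_\theta\in G$, and let $\chi_1,\dots,\chi_\theta: G\to\Bbbk^\times$ be characters such that $m_i:=\operatorname{ord}(\chi_i(g_i))\ge 2$ for all $i$ and $\chi_j(g_i)\chi_i(g_j)=1$ for all $i\ne j$. Let $B=B(G,\underline g,\underline\chi)$ be the rank $\theta$ bosonization of a quantum linear space, that is, the Hopf algebra generated over $\Bbbk$ by the group $G$, whose elements are grouplike, and by elements $x_1,\dots,x_\theta$ with $\Delta(x_i)=g_i\otimes x_i+x_i\otimes 1$, subject to the relations of $G$ and $$g x_i=\chi_i(g)\,x_i g,\qquad x_i^{m_i}=0,\qquad x_ix_j=\chi_j(g_i)\,x_jx_i\quad (g\in G,\ i\neq j).$$ Let $R$ be a left $B$-module algebra, i.e. an algebra that is a left $B$-module with $h\cdot 1=\varepsilon(h)1$ and $h\cdot(rs)=\sum (h_1\cdot r)(h_2\cdot s)$. Write $x_i(r)=x_i\cdot r$ and $R^{\langle x_i\rangle}=\{r\in R: x_i(r)=0\}$.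 Let $R\# B$ be the smash product, that is, $R\otimes_{\Bbbk} B$ with the multiplication $(r\# h)(r'\# h')=\sum r(h_1\cdot r')\# h_2h'$. Call a ring semiprime if it has no nonzero nilpotent two-sided ideal. **Theorem.** The ring $R\# B$ is semiprime if and only if, after possibly reordering the indices $1,\dots,\theta$ (that is, for some permutation of the pairs $(g_i,\chi_i)$ and correspondingly of the $x_i$), the following three conditions hold: 1. the subalgebra $\bigcap_{i=1}^{\theta} R^{\langle x_i\rangle}$ is semiprime; 2. $x_\theta(L)\neq 0$ for every nonzero left ideal $L$ of $R$; 3. for every $k\in\{1,\dots,\theta-1\}$, $x_k(L)\ne 0$ for every nonzero left ideal $L$ of $\bigcap_{j=k+1}^{\theta}R^{\langle x_j\rangle}$. (If $\theta=0$, the intersection in 1. is $R$ and conditions 2. and 3. are void.) -/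

import Mathlib

open scoped TensorProduct

noncomputable section

/-! ### Semiprime rings -/

/-- A (not necessarily commutative) ring is semiprime if it has no nonzero nilpotent two-sided
ideal. In Mathlib `Ideal A` is the type of left ideals of `A`. -/
def IsSemiprimeRing (A : Type*) [Ring A] : Prop :=
  ∀ I : Ideal A, I.IsTwoSided → ∀ n : ℕ, I ^ n = ⊥ → I = ⊥

/-! ### Module algebras and smash products -/

section Smash

variable (k R H : Type*) [CommRing k] [Ring R] [Algebra k R] [Ring H] [Bialgebra k H]
  [Module H R] [IsScalarTower k H R]

variable {R} in
/-- The `k`-linear map `H → R`, `h ↦ h · r`. -/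
def orbitMap (r : R) : H →ₗ[k] R := (LinearMap.toSpanSingleton H R r).restrictScalars k

variable {k R H} in
@[simp] theorem orbitMap_apply (r : R) (h : H) : orbitMap k H r h = h • r := rfl

/-- A `k`-algebra `R` that is a left `H`-module is a left `H`-module algebra if
`h · 1 = ε(h) 1` and `h · (r s) = ∑ (h₁ · r) (h₂ · s)`. -/
class IsModuleAlgebra : Prop where
  smul_one' : ∀ h : H, h • (1 : R) = Coalgebra.counit (R := k) h • (1 : R)
  smul_mul' : ∀ (h : H) (r s : R), h • (r * s) =
    LinearMap.mul' k R (TensorProduct.map (orbitMap k H r) (orbitMap k H s)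
      (Coalgebra.comul (R := k) h))

/-- The underlying `k`-vector space `R ⊗ H` of the smash product `R # H`. -/
def SmashProduct : Type _ := R ⊗[k] H

namespace SmashProduct

instance : AddCommGroup (SmashProduct k R H) := inferInstanceAs (AddCommGroup (R ⊗[k] H))

instance : Module k (SmashProduct k R H) := inferInstanceAs (Module k (R ⊗[k] H))

variable {R H} in
/-- The element `r # h` of the smash product. -/
def mk (r : R) (h : H) : SmashProduct k R H := r ⊗ₜ[k] h

/-- The diagonal action of `H` on `R ⊗ H`, that is `h · (r ⊗ h') = ∑ (h₁ · r) ⊗ h₂ h'`. -/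
def diag : H →ₐ[k] Module.End k (R ⊗[k] H) :=
  (Module.endTensorEndAlgHom (R := k) (A := k) (M := R) (N := H)).comp
    ((Algebra.TensorProduct.map (Algebra.lsmul k k R) (Algebra.lsmul k k H)).comp
      (Bialgebra.comulAlgHom k H))

variable {R} in
/-- The map `r' ⊗ h' ↦ r r' ⊗ h'`. -/
def mulL (r : R) : Module.End k (R ⊗[k] H) := (LinearMap.mulLeft k r).rTensor H

/-- The multiplication of the smash product as a bilinear map:
`(r ⊗ h) (r' ⊗ h') = ∑ r (h₁ · r') ⊗ h₂ h'`. -/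
def mulMap : R ⊗[k] H →ₗ[k] R ⊗[k] H →ₗ[k] R ⊗[k] H :=
  TensorProduct.lift (LinearMap.mk₂ k (fun r h => mulL k H r ∘ₗ diag k R H h)
    (fun r s h => by
      rw [← LinearMap.add_comp]; congr 1; ext; simp [mulL, add_mul, TensorProduct.add_tmul])
    (fun c r h => by
      rw [← LinearMap.smul_comp]; congr 1; ext; simp [mulL, TensorProduct.smul_tmul'])
    (fun r h h' => by ext; simp)
    (fun c r h => by ext; simp))

variable {k R H}

@[simp] theorem mulL_tmul (r s : R) (h : H) : mulL k H r (s ⊗ₜ h) = (r * s) ⊗ₜ h := rfl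

theorem diag_tmul (h h' : H) (r : R) :
    diag k R H h (r ⊗ₜ h') =
      TensorProduct.map (orbitMap k H r) (LinearMap.mulRight k h') (Coalgebra.comul (R := k) h) := by
  simp only [diag, AlgHom.comp_apply, Bialgebra.comulAlgHom_apply]
  induction Coalgebra.comul (R := k) h using TensorProduct.induction_on with
  | zero => simp
  | add x y hx hy => simp [hx, hy]
  | tmul a b => simp [Module.endTensorEndAlgHom]

theorem mulMap_tmul (r : R) (h : H) (z : R ⊗[k] H) :
    mulMap k R H (r ⊗ₜ h) z = mulL k H r (diag k R H h z) := by
  simp [mulMap]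

theorem mulMap_mulL (r : R) (w z : R ⊗[k] H) :
    mulMap k R H (mulL k H r w) z = mulL k H r (mulMap k R H w z) := by
  induction w using TensorProduct.induction_on with
  | zero => simp
  | add x y hx hy => simp [hx, hy]
  | tmul a b =>
    simp only [mulL_tmul, mulMap_tmul]
    induction diag k R H b z using TensorProduct.induction_on with
    | zero => simp
    | add x y hx hy => simp only [map_add, hx, hy]
    | tmul a b => simp [mul_assoc]

variable [IsModuleAlgebra k R H]

theorem diag_mulL_tmul (h h'' : H) (r' r'' : R) :
    diag k R H h (mulL k H r' (r'' ⊗ₜ h'')) =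
      mulMap k R H (TensorProduct.map (orbitMap k H r') LinearMap.id (Coalgebra.comul (R := k) h))
        (r'' ⊗ₜ h'') := by
  let T : H ⊗[k] (H ⊗[k] H) →ₗ[k] R ⊗[k] H :=
    TensorProduct.map (LinearMap.mul' k R) LinearMap.id ∘ₗ
      (TensorProduct.assoc k R R H).symm.toLinearMap ∘ₗ
        TensorProduct.map (orbitMap k H r')
          (TensorProduct.map (orbitMap k H r'') (LinearMap.mulRight k h''))
  have key := congrArg T (Coalgebra.coassoc_apply (R := k) h)
  have h1 : ∀ u : H ⊗[k] H, T (TensorProduct.assoc k H H H (Coalgebra.comul.rTensor H u)) =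
      TensorProduct.map (orbitMap k H (r' * r'')) (LinearMap.mulRight k h'') u := by
    intro u
    induction u using TensorProduct.induction_on with
    | zero => simp
    | add x y hx hy => simp only [map_add, hx, hy]
    | tmul a b =>
      simp only [LinearMap.rTensor_tmul, TensorProduct.map_tmul, orbitMap_apply,
        IsModuleAlgebra.smul_mul' (k := k) a r' r'']
      induction Coalgebra.comul (R := k) a using TensorProduct.induction_on with
      | zero => simp
      | add x y hx hy => simp only [TensorProduct.add_tmul, map_add, hx, hy]
      | tmul c d => simp [T]
  have h2 : ∀ u : H ⊗[k] H, T (Coalgebra.comul.lTensor H u) =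
      mulMap k R H (TensorProduct.map (orbitMap k H r') LinearMap.id u) (r'' ⊗ₜ h'') := by
    intro u
    induction u using TensorProduct.induction_on with
    | zero => simp
    | add x y hx hy => simp only [map_add, hx, hy, LinearMap.add_apply]
    | tmul a b =>
      simp only [LinearMap.lTensor_tmul, TensorProduct.map_tmul, orbitMap_apply, mulMap_tmul,
        LinearMap.id_apply, diag_tmul]
      induction Coalgebra.comul (R := k) b using TensorProduct.induction_on with
      | zero => simp
      | add x y hx hy => simp only [TensorProduct.tmul_add, map_add, hx, hy]
      | tmul c d => simp [T]
  rw [h1, h2] at key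
  rw [mulL_tmul, diag_tmul, key]

theorem diag_mulL (h : H) (r : R) (z : R ⊗[k] H) :
    diag k R H h (mulL k H r z) =
      mulMap k R H (TensorProduct.map (orbitMap k H r) LinearMap.id (Coalgebra.comul (R := k) h))
        z := by
  induction z using TensorProduct.induction_on with
  | zero => simp
  | add x y hx hy => simp only [map_add, hx, hy]
  | tmul a b => exact diag_mulL_tmul h b r a

theorem mulMap_assoc (x y z : R ⊗[k] H) :
    mulMap k R H (mulMap k R H x y) z = mulMap k R H x (mulMap k R H y z) := by
  induction x using TensorProduct.induction_on with
  | zero => simp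
  | add x y hx hy => simp only [map_add, LinearMap.add_apply, hx, hy]
  | tmul r h =>
    induction y using TensorProduct.induction_on with
    | zero => simp
    | add x y hx hy => simp only [map_add, LinearMap.add_apply, hx, hy]
    | tmul r' h' =>
      simp only [mulMap_tmul, mulMap_mulL, diag_mulL]
      congr 1
      rw [diag_tmul]
      induction Coalgebra.comul (R := k) h using TensorProduct.induction_on with
      | zero => simp
      | add x y hx hy => simp only [map_add, LinearMap.add_apply, hx, hy]
      | tmul a b => simp [mulMap_tmul]

theorem one_mulMap (z : R ⊗[k] H) : mulMap k R H (1 ⊗ₜ 1) z = z := by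
  simp [mulMap_tmul, mulL]

theorem mulMap_one (z : R ⊗[k] H) : mulMap k R H z (1 ⊗ₜ 1) = z := by
  induction z using TensorProduct.induction_on with
  | zero => simp
  | add x y hx hy => simp only [map_add, LinearMap.add_apply, hx, hy]
  | tmul r h =>
    have h1 : ∀ u : H ⊗[k] H, TensorProduct.map (orbitMap k H (1 : R)) (LinearMap.mulRight k 1) u =
        1 ⊗ₜ TensorProduct.lid k H (Coalgebra.counit.rTensor H u) := by
      intro u
      induction u using TensorProduct.induction_on with
      | zero => simp
      | add x y hx hy => simp only [map_add, TensorProduct.tmul_add, hx, hy]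
      | tmul a b =>
        simp [IsModuleAlgebra.smul_one' (k := k) (R := R) a, TensorProduct.smul_tmul]
    rw [mulMap_tmul, diag_tmul, h1, Coalgebra.rTensor_counit_comul]
    simp

variable (k R H) in
/-- The smash product algebra `R # H`. -/
instance : Ring (SmashProduct k R H) where
  mul x y := mulMap k R H x y
  one := (1 : R) ⊗ₜ[k] (1 : H)
  left_distrib x y z := map_add (mulMap k R H x) y z
  right_distrib x y z := LinearMap.map_add₂ (mulMap k R H) x y z
  zero_mul x := LinearMap.map_zero₂ (mulMap k R H) x
  mul_zero x := map_zero (mulMap k R H x)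
  mul_assoc := mulMap_assoc
  one_mul := one_mulMap
  mul_one := mulMap_one
  neg_add_cancel x := neg_add_cancel x
  zsmul := zsmulRec

/-- The multiplication rule `(r # h) (r' # h') = ∑ r (h₁ · r') # h₂ h'` in Sweedler notation. -/
theorem mk_mul_mk (r r' : R) (h h' : H) {ι : Type*} (𝓡 : Coalgebra.Repr k h ι) :
    mk k r h * mk k r' h' =
      ∑ i ∈ 𝓡.index, mk k (r * (𝓡.left i • r')) (𝓡.right i * h') := by
  change mulMap k R H (r ⊗ₜ h) (r' ⊗ₜ h') = ∑ i ∈ 𝓡.index, (_ ⊗ₜ[k] _ : R ⊗[k] H)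
  rw [mulMap_tmul, diag_tmul, ← 𝓡.eq]
  simp

theorem one_def : (1 : SmashProduct k R H) = mk k 1 1 := rfl

end SmashProduct

end Smash

/-! ### A `q`-binomial identity -/

section QBinomial

variable {k : Type*} [Field k]

/-- Gaussian binomial coefficients. -/
def gaussBinom (q : k) : ℕ → ℕ → k
  | _, 0 => 1
  | 0, _ + 1 => 0
  | n + 1, j + 1 => gaussBinom q n j + q ^ (j + 1) * gaussBinom q n (j + 1)

/-- The `q`-integer `1 + q + ⋯ + q ^ (n - 1)`. -/
def qInt (q : k) (n : ℕ) : k := ∑ i ∈ Finset.range n, q ^ i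

theorem gaussBinom_eq_zero (q : k) (n j : ℕ) (h : n < j) : gaussBinom q n j = 0 := by
  induction n generalizing j with
  | zero => cases j with
    | zero => omega
    | succ j => rfl
  | succ n ih => cases j with
    | zero => omega
    | succ j => simp [gaussBinom, ih j (by omega), ih (j + 1) (by omega)]

theorem gaussBinom_zero (q : k) (n : ℕ) : gaussBinom q n 0 = 1 := by cases n <;> rfl

theorem gaussBinom_self (q : k) (n : ℕ) : gaussBinom q n n = 1 := by
  induction n with
  | zero => rfl
  | succ n ih => simp [gaussBinom, ih, gaussBinom_eq_zero q n (n + 1) (by omega)]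

theorem qInt_succ (q : k) (n : ℕ) : qInt q (n + 1) = 1 + q * qInt q n := by
  simp [qInt, Finset.sum_range_succ', Finset.mul_sum, pow_succ', add_comm]

theorem qInt_succ' (q : k) (n : ℕ) : qInt q (n + 1) = qInt q n + q ^ n := by
  simp [qInt, Finset.sum_range_succ]

theorem gaussBinom_succ (q : k) (n j : ℕ) : gaussBinom q (n + 1) (j + 1) =
    gaussBinom q n j + q ^ (j + 1) * gaussBinom q n (j + 1) := rfl

theorem gaussBinom_mul (q : k) (n j : ℕ) :
    qInt q (j + 1) * gaussBinom q (n + 1) (j + 1) = qInt q (n + 1) * gaussBinom q n j := by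
  induction n generalizing j with
  | zero => cases j <;> simp [gaussBinom]
  | succ n ih =>
    have e1 := ih j
    cases j with
    | zero =>
      have h0 : qInt q (0 + 1) = 1 := by simp [qInt]
      rw [gaussBinom_succ, gaussBinom_zero, qInt_succ q (n + 1)]
      rw [h0, gaussBinom_zero] at e1
      rw [h0]
      linear_combination q * e1
    | succ j =>
      have e2 := ih j
      have e3 := gaussBinom_succ q n j
      rw [gaussBinom_succ q (n + 1), qInt_succ q (n + 1)]
      rw [mul_add, qInt_succ q (j + 1)] at *
      linear_combination q * e2 + q ^ (j + 2) * e1 - q * qInt q (n + 1) * e3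

theorem qInt_orderOf (q : k) (hq : q ≠ 1) : qInt q (orderOf q) = 0 := by
  have := geom_sum_mul q (orderOf q)
  rw [pow_orderOf_eq_one, sub_self] at this
  exact (mul_eq_zero.1 this).resolve_right (sub_ne_zero.2 hq)

theorem qInt_ne_zero (q : k) (n : ℕ) (h0 : 0 < n) (hn : n < orderOf q) : qInt q n ≠ 0 := by
  intro h
  have := geom_sum_mul q n
  rw [show ∑ i ∈ Finset.range n, q ^ i = 0 from h, zero_mul] at this
  exact pow_ne_one_of_lt_orderOf h0.ne' hn (sub_eq_zero.1 this.symm)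

theorem gaussBinom_orderOf (q : k) (hq : q ≠ 1) (j : ℕ) (h0 : 0 < j) (hj : j < orderOf q) :
    gaussBinom q (orderOf q) j = 0 := by
  obtain ⟨j, rfl⟩ := Nat.exists_eq_succ_of_ne_zero h0.ne'
  obtain ⟨n, hn⟩ := Nat.exists_eq_succ_of_ne_zero (show orderOf q ≠ 0 by omega)
  have := gaussBinom_mul q n j
  rw [show n + 1 = orderOf q from hn.symm, qInt_orderOf q hq, zero_mul] at this
  exact (mul_eq_zero.1 this).resolve_left (qInt_ne_zero q _ h0 hj)

theorem add_pow_gaussBinom {A : Type*} [Ring A] [Algebra k A] (q : k) (a b : A)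
    (h : b * a = q • (a * b)) (n : ℕ) :
    (a + b) ^ n = ∑ j ∈ Finset.range (n + 1), gaussBinom q n j • (a ^ j * b ^ (n - j)) := by
  have hb : ∀ j, b * a ^ j = q ^ j • (a ^ j * b) := by
    intro j
    induction j with
    | zero => simp
    | succ j ih =>
      rw [pow_succ, ← mul_assoc, ih, smul_mul_assoc, mul_assoc, h, mul_smul_comm, smul_smul,
        ← pow_succ, mul_assoc]
  induction n with
  | zero => simp [gaussBinom]
  | succ n ih =>
    rw [pow_succ', ih, add_mul, Finset.mul_sum, Finset.mul_sum,
      Finset.sum_range_succ' _ (n + 1)]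
    have e : ∀ j ∈ Finset.range (n + 1),
        gaussBinom q (n + 1) (j + 1) • (a ^ (j + 1) * b ^ (n + 1 - (j + 1))) =
        a * (gaussBinom q n j • (a ^ j * b ^ (n - j))) +
          (q ^ (j + 1) * gaussBinom q n (j + 1)) • (a ^ (j + 1) * b ^ (n - j)) := by
      intro j _
      rw [gaussBinom_succ, add_smul, mul_smul_comm, Nat.add_sub_add_right, ← mul_assoc, ← pow_succ']
    rw [Finset.sum_congr rfl e, Finset.sum_add_distrib, add_assoc]
    congr 1
    have e2 : ∀ j ∈ Finset.range (n + 1), b * (gaussBinom q n j • (a ^ j * b ^ (n - j))) =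
        (q ^ j * gaussBinom q n j) • (a ^ j * b ^ (n + 1 - j)) := by
      intro j hj
      rw [Finset.mem_range] at hj
      rw [mul_smul_comm, ← mul_assoc, hb, smul_mul_assoc, smul_smul, mul_assoc, ← pow_succ',
        mul_comm (gaussBinom q n j), show n - j + 1 = n + 1 - j by omega]
    rw [Finset.sum_congr rfl e2, Finset.sum_range_succ' _ n, Finset.sum_range_succ _ n,
      gaussBinom_eq_zero q n (n + 1) (by omega)]
    simp [gaussBinom_zero]

/-- If `b a = q a b` where `q ≠ 1` has finite order `m`, then `(a + b) ^ m = a ^ m + b ^ m`. -/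
theorem add_pow_orderOf {A : Type*} [Ring A] [Algebra k A] (q : k) (hq : 2 ≤ orderOf q) (a b : A)
    (h : b * a = q • (a * b)) :
    (a + b) ^ orderOf q = a ^ orderOf q + b ^ orderOf q := by
  have hq1 : q ≠ 1 := by rintro rfl; simp at hq
  rw [add_pow_gaussBinom q a b h, Finset.sum_range_succ, gaussBinom_self]
  rw [Finset.sum_eq_single_of_mem 0 (Finset.mem_range.2 (by omega))]
  · simp [gaussBinom_zero, add_comm]
  · intro j hj hj0
    rw [gaussBinom_orderOf q hq1 j (Nat.pos_of_ne_zero hj0) (Finset.mem_range.1 hj), zero_smul]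

end QBinomial

/-! ### Bosonizations of quantum linear spaces -/

/-- A datum `(G, g, χ)` of rank `θ`: elements `g₁, …, g_θ` of `G` and characters `χ₁, …, χ_θ`
of `G` with `ord χᵢ(gᵢ) ≥ 2` and `χⱼ(gᵢ) χᵢ(gⱼ) = 1` for `i ≠ j`. -/
structure QLSDatum (k G : Type*) [Field k] [CommGroup G] (θ : ℕ) where
  g : Fin θ → G
  χ : Fin θ → (G →* kˣ)
  two_le_orderOf : ∀ i, 2 ≤ orderOf (χ i (g i))
  braid : ∀ i j, i ≠ j → χ j (g i) * χ i (g j) = 1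

namespace QLSDatum

variable {k G : Type*} [Field k] [CommGroup G] {θ : ℕ} (D : QLSDatum k G θ)

/-- `mᵢ = ord χᵢ(gᵢ)`. -/
def m (i : Fin θ) : ℕ := orderOf (D.χ i (D.g i))

open FreeAlgebra in
/-- The defining relations of `B(G, g, χ)`, on generators `G ⊔ {x₁, …, x_θ}`; the first two say
that the multiplication of the generators in `G` is that of the group. -/
inductive Rel : FreeAlgebra k (G ⊕ Fin θ) → FreeAlgebra k (G ⊕ Fin θ) → Prop
  | one : Rel (ι k (.inl 1)) 1
  | mul (a b : G) : Rel (ι k (.inl a) * ι k (.inl b)) (ι k (.inl (a * b)))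
  | grp_x (a : G) (i : Fin θ) : Rel (ι k (.inl a) * ι k (.inr i))
      ((D.χ i a : k) • (ι k (.inr i) * ι k (.inl a)))
  | x_pow (i : Fin θ) : Rel (ι k (.inr i) ^ D.m i) 0
  | x_x (i j : Fin θ) (hij : i ≠ j) : Rel (ι k (.inr i) * ι k (.inr j))
      ((D.χ j (D.g i) : k) • (ι k (.inr j) * ι k (.inr i)))

/-- The algebra `B(G, g, χ)`: the bosonization of a quantum linear space. -/
def Boson : Type _ := RingQuot D.Rel

namespace Boson

instance : Ring D.Boson := inferInstanceAs (Ring (RingQuot D.Rel))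

instance : Algebra k D.Boson := inferInstanceAs (Algebra k (RingQuot D.Rel))

/-- The projection from the free algebra. -/
def proj : FreeAlgebra k (G ⊕ Fin θ) →ₐ[k] D.Boson := RingQuot.mkAlgHom k D.Rel

theorem proj_rel {a b : FreeAlgebra k (G ⊕ Fin θ)} (h : D.Rel a b) : proj D a = proj D b :=
  RingQuot.mkAlgHom_rel k h

/-- The generators in `G`. -/
def grp : G →* D.Boson where
  toFun a := proj D (FreeAlgebra.ι k (.inl a))
  map_one' := (proj_rel D .one).trans (map_one _)
  map_mul' a b := (proj_rel D (.mul a b)).symm.trans (map_mul _ _ _)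

/-- The generators `xᵢ`. -/
def x (i : Fin θ) : D.Boson := proj D (FreeAlgebra.ι k (.inr i))

theorem grp_mul_x (a : G) (i : Fin θ) :
    grp D a * x D i = (D.χ i a : k) • (x D i * grp D a) := by
  simpa [grp, x] using proj_rel D (.grp_x a i)

theorem x_pow (i : Fin θ) : x D i ^ D.m i = 0 := by
  simpa [x] using proj_rel D (.x_pow i)

theorem x_mul_x (i j : Fin θ) (hij : i ≠ j) :
    x D i * x D j = (D.χ j (D.g i) : k) • (x D j * x D i) := by
  simpa [x] using proj_rel D (.x_x i j hij)

section lift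

variable {A : Type*} [Ring A] [Algebra k A]

variable {D} in
@[ext] theorem algHom_ext {f f' : D.Boson →ₐ[k] A} (h1 : ∀ a, f (grp D a) = f' (grp D a))
    (h2 : ∀ i, f (x D i) = f' (x D i)) : f = f' := by
  refine RingQuot.ringQuot_ext' (S := k) (s := D.Rel) f f' (FreeAlgebra.hom_ext (funext ?_))
  rintro (a | i)
  · exact h1 a
  · exact h2 i

/-- The universal property of `B(G, g, χ)`. -/
def lift (γ : G →* A) (ξ : Fin θ → A)
    (h1 : ∀ a i, γ a * ξ i = (D.χ i a : k) • (ξ i * γ a))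
    (h2 : ∀ i, ξ i ^ D.m i = 0)
    (h3 : ∀ i j, i ≠ j → ξ i * ξ j = (D.χ j (D.g i) : k) • (ξ j * ξ i)) :
    D.Boson →ₐ[k] A :=
  RingQuot.liftAlgHom k ⟨FreeAlgebra.lift k (Sum.elim γ ξ), by
    intro a b h
    induction h with
    | one => simp
    | mul a b => simp
    | grp_x a i => simp [h1]
    | x_pow i => simp [h2]
    | x_x i j hij => simp [h3 i j hij]⟩

variable (γ : G →* A) (ξ : Fin θ → A)
    (h1 : ∀ a i, γ a * ξ i = (D.χ i a : k) • (ξ i * γ a))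
    (h2 : ∀ i, ξ i ^ D.m i = 0)
    (h3 : ∀ i j, i ≠ j → ξ i * ξ j = (D.χ j (D.g i) : k) • (ξ j * ξ i))

@[simp] theorem lift_grp (a : G) : lift D γ ξ h1 h2 h3 (grp D a) = γ a := by
  refine (RingQuot.liftAlgHom_mkAlgHom_apply k _ _ _).trans ?_
  simp

@[simp] theorem lift_x (i : Fin θ) : lift D γ ξ h1 h2 h3 (x D i) = ξ i := by
  refine (RingQuot.liftAlgHom_mkAlgHom_apply k _ _ _).trans ?_
  simp

end lift

theorem induction {P : D.Boson → Prop} (hgrp : ∀ a, P (grp D a)) (hx : ∀ i, P (x D i))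
    (hc : ∀ c : k, P (algebraMap k _ c)) (hadd : ∀ a b, P a → P b → P (a + b))
    (hmul : ∀ a b, P a → P b → P (a * b)) (a : D.Boson) : P a := by
  obtain ⟨a, rfl⟩ := RingQuot.mkAlgHom_surjective k D.Rel a
  change P (proj D a)
  induction a using FreeAlgebra.induction with
  | grade0 c => rw [AlgHom.commutes]; exact hc c
  | grade1 i =>
    rcases i with a | i
    · exact hgrp a
    · exact hx i
  | mul a b ha hb => rw [map_mul]; exact hmul _ _ ha hb
  | add a b ha hb => rw [map_add]; exact hadd _ _ ha hb

theorem two_le_orderOf_coe (i : Fin θ) : 2 ≤ orderOf (D.χ i (D.g i) : k) := by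
  rw [orderOf_units]; exact D.two_le_orderOf i

theorem m_ne_zero (i : Fin θ) : D.m i ≠ 0 := by
  have := D.two_le_orderOf i
  unfold m; omega

theorem braid_coe (i j : Fin θ) (hij : i ≠ j) :
    (D.χ j (D.g i) : k) * (D.χ i (D.g j) : k) = 1 := by
  rw [← Units.val_mul, D.braid i j hij, Units.val_one]

/-- The map `a ↦ a ⊗ a` on `G`. -/
def grpDiag : G →* D.Boson ⊗[k] D.Boson where
  toFun a := grp D a ⊗ₜ grp D a
  map_one' := by simp [Algebra.TensorProduct.one_def]
  map_mul' a b := by simp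

theorem grpDiag_apply (a : G) : grpDiag D a = grp D a ⊗ₜ grp D a := rfl

/-- The comultiplication: `Δ(a) = a ⊗ a` for `a ∈ G` and `Δ(xᵢ) = gᵢ ⊗ xᵢ + xᵢ ⊗ 1`. -/
def comulHom : D.Boson →ₐ[k] D.Boson ⊗[k] D.Boson :=
  lift D
    (grpDiag D)
    (fun i => grp D (D.g i) ⊗ₜ x D i + x D i ⊗ₜ 1)
    (fun a i => by
      simp only [grpDiag_apply, mul_add, add_mul,
        Algebra.TensorProduct.tmul_mul_tmul, grp_mul_x, smul_add, ← map_mul, mul_comm a, mul_one,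
        one_mul, TensorProduct.tmul_smul, TensorProduct.smul_tmul'])
    (fun i => by
      rw [m, ← orderOf_units, add_comm, add_pow_orderOf _ (two_le_orderOf_coe D i)]
      · rw [Algebra.TensorProduct.tmul_pow, Algebra.TensorProduct.tmul_pow, orderOf_units]
        have := x_pow D i
        rw [m] at this
        simp [this]
      · simp [Algebra.TensorProduct.tmul_mul_tmul, grp_mul_x, TensorProduct.smul_tmul'])
    (fun i j hij => by
      have e1 := x_mul_x D i j hij
      have e2 := grp_mul_x D (D.g i) j
      have e3 : x D i * grp D (D.g j) =
          (D.χ j (D.g i) : k) • (grp D (D.g j) * x D i) := by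
        rw [grp_mul_x, smul_smul, braid_coe D i j hij, one_smul]
      simp only [mul_add, add_mul, Algebra.TensorProduct.tmul_mul_tmul, mul_one, one_mul, e1, e2,
        e3, smul_add, TensorProduct.tmul_smul, TensorProduct.smul_tmul', ← map_mul,
        mul_comm (D.g i)]
      abel)

/-- The counit: `ε(a) = 1` for `a ∈ G` and `ε(xᵢ) = 0`. -/
def counitHom : D.Boson →ₐ[k] k :=
  lift D 1 0 (by simp) (by simp [m_ne_zero]) (by simp)

@[simp] theorem comulHom_grp (a : G) : comulHom D (grp D a) = grp D a ⊗ₜ grp D a := by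
  simp [comulHom, grpDiag_apply]

@[simp] theorem comulHom_x (i : Fin θ) :
    comulHom D (x D i) = grp D (D.g i) ⊗ₜ x D i + x D i ⊗ₜ 1 := by
  simp [comulHom]

@[simp] theorem counitHom_grp (a : G) : counitHom D (grp D a) = 1 := by
  simp [counitHom]

@[simp] theorem counitHom_x (i : Fin θ) : counitHom D (x D i) = 0 := by
  simp [counitHom]

instance : Bialgebra k D.Boson :=
  Bialgebra.ofAlgHom (comulHom D) (counitHom D)
    (by
      ext
      · simp
      · simp [TensorProduct.tmul_add, TensorProduct.add_tmul, Algebra.TensorProduct.one_def]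
        try abel)
    (by ext <;> simp)
    (by ext <;> simp)

theorem comul_grp (a : G) : Coalgebra.comul (R := k) (grp D a) = grp D a ⊗ₜ grp D a :=
  comulHom_grp D a

theorem comul_x (i : Fin θ) :
    Coalgebra.comul (R := k) (x D i) = grp D (D.g i) ⊗ₜ x D i + x D i ⊗ₜ 1 :=
  comulHom_x D i

theorem counit_grp (a : G) : Coalgebra.counit (R := k) (grp D a) = 1 := counitHom_grp D a

theorem counit_x (i : Fin θ) : Coalgebra.counit (R := k) (x D i) = 0 := counitHom_x D i

theorem grp_inv_mul_x (a : G) (i : Fin θ) :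
    x D i * grp D a = (D.χ i a⁻¹ : k) • (grp D a * x D i) := by
  rw [grp_mul_x, smul_smul, ← Units.val_mul, ← map_mul]; simp

theorem skew_pow (i : Fin θ) (n : ℕ) :
    ∃ c : k, (grp D (D.g i)⁻¹ * x D i) ^ n = c • (x D i ^ n * grp D ((D.g i)⁻¹ ^ n)) := by
  have hx : ∀ (n : ℕ) (a : G), ∃ c : k, grp D a * x D i ^ n = c • (x D i ^ n * grp D a) := by
    intro n a
    induction n with
    | zero => exact ⟨1, by simp⟩
    | succ n ih =>
      obtain ⟨c, hc⟩ := ih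
      refine ⟨c * D.χ i a, ?_⟩
      rw [pow_succ, ← mul_assoc, hc, smul_mul_assoc, mul_assoc, grp_mul_x, mul_smul_comm,
        smul_smul, mul_assoc]
  induction n with
  | zero => exact ⟨1, by simp⟩
  | succ n ih =>
    obtain ⟨c, hc⟩ := ih
    obtain ⟨d, hd⟩ := hx (n + 1) (D.g i)⁻¹
    refine ⟨c * D.χ i ((D.g i)⁻¹ ^ (n + 1)), ?_⟩
    rw [pow_succ, hc, smul_mul_assoc, mul_assoc, ← mul_assoc (grp D _) (grp D _) (x D i),
      ← map_mul, ← pow_succ, grp_mul_x, mul_smul_comm, smul_smul, ← mul_assoc, ← pow_succ]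

/-- The antipode as an algebra map to the opposite algebra: `a ↦ a⁻¹` for `a ∈ G` and
`xᵢ ↦ -gᵢ⁻¹ xᵢ`. -/
def antipodeHom : D.Boson →ₐ[k] D.Bosonᵐᵒᵖ :=
  lift D
    { toFun := fun a => MulOpposite.op (grp D a⁻¹)
      map_one' := by simp
      map_mul' := fun a b => by rw [← MulOpposite.op_mul, ← map_mul, mul_inv_rev] }
    (fun i => MulOpposite.op (-(grp D (D.g i)⁻¹ * x D i)))
    (fun a i => by
      apply MulOpposite.unop_injective
      simp only [MonoidHom.coe_mk, OneHom.coe_mk, MulOpposite.unop_mul, MulOpposite.unop_op,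
        MulOpposite.unop_smul]
      rw [neg_mul, mul_assoc, grp_inv_mul_x, inv_inv, mul_smul_comm, ← mul_assoc, ← map_mul,
        mul_neg, smul_neg, ← mul_assoc, ← map_mul, mul_comm a⁻¹])
    (fun i => by
      obtain ⟨c, hc⟩ := skew_pow D i (D.m i)
      rw [← MulOpposite.op_pow, neg_pow, hc, x_pow]
      simp)
    (fun i j hij => by
      apply MulOpposite.unop_injective
      simp only [MulOpposite.unop_mul, MulOpposite.unop_op, MulOpposite.unop_smul, neg_mul_neg]
      have e : ∀ i j : Fin θ, grp D (D.g i)⁻¹ * x D i * (grp D (D.g j)⁻¹ * x D j) =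
          (D.χ i (D.g j) : k) • (grp D ((D.g i)⁻¹ * (D.g j)⁻¹) * (x D i * x D j)) := by
        intro i j
        rw [mul_assoc, ← mul_assoc (x D i), grp_inv_mul_x D _ i, inv_inv, smul_mul_assoc,
          mul_smul_comm, mul_assoc (grp D _) (x D i), ← mul_assoc (grp D _) (grp D _), ← map_mul]
      rw [e i j, e j i, x_mul_x D i j hij, mul_smul_comm, smul_smul, smul_smul,
        mul_comm (D.g i)⁻¹, braid_coe D i j hij, one_mul])

instance : HopfAlgebra k D.Boson where
  antipode := (MulOpposite.opLinearEquiv k).symm.toLinearMap ∘ₗ (antipodeHom D).toLinearMap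
  mul_antipode_rTensor_comul := by
    set S : D.Boson →ₗ[k] D.Boson :=
      (MulOpposite.opLinearEquiv k).symm.toLinearMap ∘ₗ (antipodeHom D).toLinearMap with hS
    have hSmul : ∀ a b, S (a * b) = S b * S a := fun a b => by simp [hS]
    have F1 : ∀ (s : D.Boson ⊗[k] D.Boson) (b c : D.Boson),
        LinearMap.mul' k D.Boson (S.rTensor D.Boson (s * b ⊗ₜ c)) =
          S b * LinearMap.mul' k D.Boson (S.rTensor D.Boson s) * c := by
      intro s b c
      induction s using TensorProduct.induction_on with
      | zero => simp
      | add x y hx hy => simp only [add_mul, map_add, mul_add, hx, hy]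
      | tmul a d => simp [hSmul, mul_assoc]
    have F2 : ∀ (s t : D.Boson ⊗[k] D.Boson) (e : k),
        LinearMap.mul' k D.Boson (S.rTensor D.Boson s) = algebraMap k _ e →
        LinearMap.mul' k D.Boson (S.rTensor D.Boson (s * t)) =
          algebraMap k _ e * LinearMap.mul' k D.Boson (S.rTensor D.Boson t) := by
      intro s t e h
      induction t using TensorProduct.induction_on with
      | zero => simp
      | add x y hx hy => simp only [map_add, mul_add, hx, hy]
      | tmul a d =>
        rw [F1, h, ← Algebra.commutes, mul_assoc]
        simp
    ext a
    simp only [LinearMap.comp_apply, Algebra.linearMap_apply]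
    induction a using induction D with
    | hgrp a => rw [comul_grp, counit_grp]; simp [hS, antipodeHom, ← map_mul]
    | hx i => rw [comul_x, counit_x]; simp [hS, antipodeHom]
    | hc c => simp [hS, Algebra.TensorProduct.algebraMap_apply]
    | hadd a b ha hb => simp only [map_add, ha, hb]
    | hmul a b ha hb =>
      rw [Bialgebra.comul_mul, F2 _ _ _ ha, hb, Bialgebra.counit_mul, map_mul]
  mul_antipode_lTensor_comul := by
    set S : D.Boson →ₗ[k] D.Boson :=
      (MulOpposite.opLinearEquiv k).symm.toLinearMap ∘ₗ (antipodeHom D).toLinearMap with hS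
    have hSmul : ∀ a b, S (a * b) = S b * S a := fun a b => by simp [hS]
    have F1 : ∀ (s : D.Boson ⊗[k] D.Boson) (b c : D.Boson),
        LinearMap.mul' k D.Boson (S.lTensor D.Boson (b ⊗ₜ c * s)) =
          b * LinearMap.mul' k D.Boson (S.lTensor D.Boson s) * S c := by
      intro s b c
      induction s using TensorProduct.induction_on with
      | zero => simp
      | add x y hx hy => simp only [add_mul, map_add, mul_add, hx, hy]
      | tmul a d => simp [hSmul, mul_assoc]
    have F2 : ∀ (s t : D.Boson ⊗[k] D.Boson) (e : k),
        LinearMap.mul' k D.Boson (S.lTensor D.Boson s) = algebraMap k _ e →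
        LinearMap.mul' k D.Boson (S.lTensor D.Boson (t * s)) =
          LinearMap.mul' k D.Boson (S.lTensor D.Boson t) * algebraMap k _ e := by
      intro s t e h
      induction t using TensorProduct.induction_on with
      | zero => simp
      | add x y hx hy => simp only [map_add, add_mul, hx, hy]
      | tmul a d =>
        rw [F1, h, mul_assoc, Algebra.commutes, ← mul_assoc]
        simp
    ext a
    simp only [LinearMap.comp_apply, Algebra.linearMap_apply]
    induction a using induction D with
    | hgrp a => rw [comul_grp, counit_grp]; simp [hS, antipodeHom, ← map_mul]
    | hx i =>
      rw [comul_x, counit_x]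
      simp [hS, antipodeHom, ← mul_assoc, ← map_mul]
    | hc c => simp [hS, Algebra.TensorProduct.algebraMap_apply]
    | hadd a b ha hb => simp only [map_add, ha, hb]
    | hmul a b ha hb =>
      rw [Bialgebra.comul_mul, F2 _ _ _ hb, ha, Bialgebra.counit_mul, map_mul]

end Boson

/-! ### The action on a module algebra -/

variable (R : Type*) [Ring R] [Algebra k R] [Module D.Boson R] [IsScalarTower k D.Boson R]
  [IsModuleAlgebra k R D.Boson]

/-- The subalgebra `R^⟨xᵢ⟩ = {r ∈ R : xᵢ(r) = 0}`. -/
def xKernel (i : Fin θ) : Subalgebra k R where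
  carrier := {r | Boson.x D i • r = 0}
  mul_mem' {r s} hr hs := by
    rw [Set.mem_ofPred_eq] at *
    rw [IsModuleAlgebra.smul_mul' (k := k), Boson.comul_x]
    simp [hr, hs]
  add_mem' {r s} hr hs := by
    rw [Set.mem_ofPred_eq] at *
    rw [smul_add, hr, hs, add_zero]
  algebraMap_mem' c := by
    rw [Set.mem_ofPred_eq, Algebra.algebraMap_eq_smul_one, smul_comm,
      IsModuleAlgebra.smul_one' (k := k), Boson.counit_x, zero_smul, smul_zero]

end QLSDatum

end

/-! Write `A` for the smash product `R # B`, `C` for the algebra of elements of `R` killed by every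
`xᵢ`, and `Λ` (`top`) for the product of the `xᵢ ^ (mᵢ - 1)`. Since `xᵢ Λ = 0`, a word `w` in the
`xᵢ` satisfies `w (r Λ) = (w · r) Λ` in `A`, so that `(l Λ)(l' Λ) = l (Λ · l') Λ`; and `r Λ = 0`
forces `r = 0`, because `Λ ≠ 0` (`top_ne_zero`).

Let `A` be semiprime. If `M ⊆ R` is stable under `G` and the `xᵢ` and `M (Λ · (R M)) = 0`, then `m Λ
A m Λ = 0` for `m ∈ M`, so `M = 0` (`eq_zero_of_isSemiprimeRing`). A failure of any of the
conditions produces a nonzero such `M`: a `G`-stable square-zero ideal of `C`, or the elements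
generating a left ideal that the next `x` kills. The ordering plays no role, so the conditions then
hold for every ordering.

Let `A` not be semiprime. The characters of `G` act on `A`, and some nonzero ideal `I` of square
zero is stable under them, hence graded by `G`. A nonzero homogeneous element of `I` can be
multiplied on the right to a nonzero `r Λ`. So `L = {l | l Λ ∈ I}` is a nonzero `B`-stable left
ideal of `R` with `L (Λ · L) = 0`, and semiprimeness of `C` gives `Λ · L = 0`. Put `J = L ∩ C`; then
`(Λ · R) J = Λ · (R J) = 0`. The letters of `Λ` are now stripped off (`eq_zero_of_top_smul_mul`): a
power `x ^ (m - 1)` descends to `x` by the `q`-Leibniz rule and semiprimeness of `C`, and the last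
`x` is removed by the condition on left ideals. What remains is `R J = 0`, so `J = 0`. As the `xᵢ`
act jointly nilpotently, a nonzero `L` would meet `C`, a contradiction. -/

/-! ### Nilpotent ideals of noncommutative rings -/

section Semiprime

variable {A : Type*} [Ring A]

theorem IsSemiprimeRing.eq_zero_of_mul_mul (h : IsSemiprimeRing A) {a : A}
    (ha : ∀ b, a * b * a = 0) : a = 0 := by
  -- The left ideal spanned by `a A` is the two-sided ideal `A a A`; its square vanishes because `a
  -- A a = 0`.
  set I : Ideal A := Ideal.span (Set.range fun b => a * b) with hI
  have hmem : ∀ b, a * b ∈ I := fun b => Ideal.subset_span ⟨b, rfl⟩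
  have h0 : ∀ s ∈ I, ∀ b, a * b * s = 0 := by
    intro s hs
    induction hs using Submodule.span_induction with
    | mem x hx =>
      obtain ⟨c, rfl⟩ := hx
      intro b
      rw [← mul_assoc, ha, zero_mul]
    | zero => simp
    | add x y _ _ hx hy => intro b; rw [mul_add, hx, hy, add_zero]
    | smul c x _ hx => intro b; rw [smul_eq_mul, ← mul_assoc, mul_assoc a, hx]
  have hT : I.IsTwoSided := by
    refine ⟨fun {s} b hs => ?_⟩
    induction hs using Submodule.span_induction with
    | mem x hx =>
      obtain ⟨c, rfl⟩ := hx
      simpa only [mul_assoc] using hmem (c * b)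
    | zero => simp
    | add x y _ _ hx hy => rw [add_mul]; exact I.add_mem hx hy
    | smul c x _ hx => rw [smul_eq_mul, mul_assoc]; exact I.mul_mem_left c hx
  have hsq : I ^ 2 = ⊥ := by
    rw [Submodule.pow_succ, Submodule.pow_one, eq_bot_iff, Ideal.mul_le]
    intro r hr s hs
    rw [Ideal.mem_bot]
    induction hr using Submodule.span_induction with
    | mem x hx =>
      obtain ⟨c, rfl⟩ := hx
      exact h0 s hs c
    | zero => simp
    | add x y _ _ hx hy => rw [add_mul, hx, hy, add_zero]
    | smul c x _ hx => rw [smul_eq_mul, mul_assoc, hx, mul_zero]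
  have := hmem 1
  rw [h I hT 2 hsq] at this
  simpa using this

theorem Ideal.isTwoSided_sup {I J : Ideal A} [I.IsTwoSided] [J.IsTwoSided] :
    (I ⊔ J).IsTwoSided := ⟨fun {a} b ha => by
  obtain ⟨c, hc, d, hd, rfl⟩ := Submodule.mem_sup.1 ha
  rw [add_mul]
  exact add_mem (Ideal.mem_sup_left (I.mul_mem_right _ hc))
    (Ideal.mem_sup_right (J.mul_mem_right _ hd))⟩

/-- Modulo `I` the sum is `J`, so a high power of it lies in `I`, and a power of that power
vanishes. -/
theorem Ideal.sup_pow_eq_bot {I J : Ideal A} [I.IsTwoSided] [J.IsTwoSided] {m n : ℕ}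
    (hI : I ^ m = ⊥) (hJ : J ^ n = ⊥) : ∃ p : ℕ, (I ⊔ J) ^ p = ⊥ := by
  have hle : ∀ j, (I ⊔ J) ^ (j + 1) ≤ I ⊔ J ^ (j + 1) := by
    intro j
    induction j with
    | zero => rw [zero_add, Submodule.pow_one, Submodule.pow_one]
    | succ j ih =>
      rw [Submodule.pow_succ (n := j + 1), Submodule.pow_succ (n := j + 1), Ideal.mul_le]
      intro r hr s hs
      obtain ⟨a, ha, b, hb, rfl⟩ := Submodule.mem_sup.1 (ih hr)
      obtain ⟨c, hc, d, hd, rfl⟩ := Submodule.mem_sup.1 hs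
      rw [add_mul, mul_add b, ← add_assoc]
      exact add_mem (Ideal.mem_sup_left (add_mem (I.mul_mem_right _ ha) (I.mul_mem_left _ hc)))
        (Ideal.mem_sup_right (Ideal.mul_mem_mul hb hd))
  have hJ' : J ^ (n + 1) = ⊥ := by rw [Submodule.pow_succ, hJ, Ideal.bot_mul]
  have h1 := hle n
  rw [hJ', sup_bot_eq] at h1
  have : (I ⊔ J).IsTwoSided := Ideal.isTwoSided_sup
  have hmono : ∀ j, (I ⊔ J) ^ ((n + 1) * j) ≤ I ^ j := by
    intro j
    induction j with
    | zero => rw [mul_zero, Submodule.pow_zero, Submodule.pow_zero]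
    | succ j ih =>
      rw [mul_add, mul_one, Ideal.IsTwoSided.pow_add, Submodule.pow_succ (M := I)]
      exact Ideal.mul_mono ih h1
  exact ⟨(n + 1) * m, by rw [eq_bot_iff, ← hI]; exact hmono m⟩

theorem Ideal.comap_pow_eq_bot {A' : Type*} [Ring A'] {f : A →+* A'} (hf : Function.Injective f)
    {I : Ideal A'} {n : ℕ} (hI : I ^ n = ⊥) : (I.comap f) ^ n = ⊥ := by
  have hle : ∀ j, (I.comap f) ^ j ≤ (I ^ j).comap f := by
    intro j
    induction j with
    | zero =>
      intro x _
      rw [Submodule.pow_zero, Ideal.one_eq_top]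
      trivial
    | succ j ih =>
      rw [Submodule.pow_succ, Submodule.pow_succ, Ideal.mul_le]
      intro r hr s hs
      rw [Ideal.mem_comap, map_mul]
      exact Ideal.mul_mem_mul (ih hr) hs
  rw [eq_bot_iff]
  intro x hx
  have := hle n hx
  rw [hI, Ideal.mem_comap, Ideal.mem_bot] at this
  exact (Ideal.mem_bot).2 (hf (by rw [this, map_zero]))

/-- Any nonzero element of the last nonvanishing power of `W` will do; that power has exponent at
least `1` because `W ≠ ⊥`. -/
theorem Ideal.exists_sq_zero_of_nilpotent {W : Ideal A} [W.IsTwoSided] {n : ℕ} (hn : W ^ n = ⊥)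
    (hW : W ≠ ⊥) : ∃ a ∈ W, a ≠ 0 ∧ ∀ v ∈ W, a * v = 0 := by
  classical
  have hex : ∃ n, W ^ n = ⊥ := ⟨n, hn⟩
  obtain ⟨p, hp⟩ : ∃ p, Nat.find hex = p + 2 := by
    have hs := Nat.find_spec hex
    rcases h : Nat.find hex with _ | _ | p
    · rw [h, Submodule.pow_zero, Ideal.one_eq_top] at hs
      exact absurd (eq_bot_iff.2 (le_top.trans_eq hs)) hW
    · rw [h, zero_add, Submodule.pow_one] at hs
      exact absurd hs hW
    · exact ⟨p, rfl⟩
  have h1 : W ^ (p + 1) ≠ ⊥ := Nat.find_min hex (by omega)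
  have h2 := Nat.find_spec hex
  rw [hp, Submodule.pow_succ (n := p + 1)] at h2
  obtain ⟨a, ha, ha0⟩ := Submodule.exists_mem_ne_zero_of_ne_bot h1
  refine ⟨a, ?_, ha0, fun v hv => ?_⟩
  · rw [Submodule.pow_succ] at ha
    exact (Ideal.mul_le.2 fun r _ s hs => W.mul_mem_left r hs) ha
  · have := Ideal.mul_mem_mul ha hv
    rwa [h2] at this

/-- A finite group of automorphisms of a ring that is not semiprime leaves invariant some nonzero
two-sided ideal of square zero. -/
theorem exists_invariant_sq_zero_ideal (hA : ¬ IsSemiprimeRing A) {Γ : Type*} [Group Γ] [Finite Γ]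
    (φ : Γ → A →+* A) (h1 : ∀ a, φ 1 a = a) (hmul : ∀ γ δ a, φ (γ * δ) a = φ γ (φ δ a)) :
    ∃ I : Ideal A, I.IsTwoSided ∧ I ≠ ⊥ ∧ (∀ γ, ∀ a ∈ I, φ γ a ∈ I) ∧
      ∀ a ∈ I, ∀ b ∈ I, a * b = 0 := by
  have := Fintype.ofFinite Γ
  unfold IsSemiprimeRing at hA
  push Not at hA
  obtain ⟨I, hI, n, hn, hI0⟩ := hA
  have hinv : ∀ γ a, φ γ⁻¹ (φ γ a) = a := fun γ a => by rw [← hmul, inv_mul_cancel, h1]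
  have hinj : ∀ γ, Function.Injective (φ γ) := fun γ a b hab => by
    rw [← hinv γ a, hab, hinv]
  -- The sum of all translates of `I`: invariant, and still nilpotent because the group is finite.
  set W : Ideal A := Finset.univ.sup fun γ => I.comap (φ γ) with hW
  obtain ⟨hWT, p, hp⟩ : W.IsTwoSided ∧ ∃ n : ℕ, W ^ n = ⊥ := by
    refine Finset.sup_induction (p := fun J : Ideal A => J.IsTwoSided ∧ ∃ n : ℕ, J ^ n = ⊥)
      ⟨inferInstance, 1, Submodule.pow_one _⟩ ?_ ?_
    · rintro J ⟨hJ, m, hm⟩ K ⟨hK, l, hl⟩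
      exact ⟨Ideal.isTwoSided_sup, Ideal.sup_pow_eq_bot hm hl⟩
    · exact fun γ _ => ⟨inferInstance, n, Ideal.comap_pow_eq_bot (hinj γ) hn⟩
  have hstab : ∀ δ, ∀ a ∈ W, φ δ a ∈ W := by
    intro δ
    change W ≤ W.comap (φ δ)
    refine Finset.sup_le fun γ _ a ha => ?_
    -- `φ δ` maps the translate for `γ` into the translate for `γ δ⁻¹`.
    refine (Finset.le_sup (f := fun γ => I.comap (φ γ)) (Finset.mem_univ (γ * δ⁻¹))) ?_
    rw [Ideal.mem_comap, hmul, hinv]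
    exact ha
  have hW0 : W ≠ ⊥ := by
    intro h
    apply hI0
    rw [eq_bot_iff, ← h]
    refine le_trans ?_ (Finset.le_sup (f := fun γ => I.comap (φ γ)) (Finset.mem_univ 1))
    intro a ha
    rwa [Ideal.mem_comap, h1]
  obtain ⟨a, haW, ha0, ha⟩ := Ideal.exists_sq_zero_of_nilpotent hp hW0
  -- The left annihilator of `W` inside `W` has square zero and inherits the invariance of `W`.
  refine ⟨{ carrier := {w | w ∈ W ∧ ∀ v ∈ W, w * v = 0}
            add_mem' := fun {x y} hx hy => ⟨add_mem hx.1 hy.1, fun v hv => by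
              rw [add_mul, hx.2 v hv, hy.2 v hv, add_zero]⟩
            zero_mem' := ⟨W.zero_mem, fun v _ => zero_mul v⟩
            smul_mem' := fun c x hx => ⟨W.mul_mem_left c hx.1, fun v hv => by
              rw [smul_eq_mul, mul_assoc, hx.2 v hv, mul_zero]⟩ }, ⟨?_⟩, ?_, ?_, ?_⟩
  · rintro x b ⟨hx, hx'⟩
    exact ⟨W.mul_mem_right _ hx, fun v hv => by rw [mul_assoc]; exact hx' _ (W.mul_mem_left _ hv)⟩
  · intro h
    have : a ∈ (⊥ : Ideal A) := by rw [← h]; exact ⟨haW, ha⟩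
    exact ha0 this
  · rintro γ x ⟨hx, hx'⟩
    refine ⟨hstab γ x hx, fun v hv => ?_⟩
    have hv' : v = φ γ (φ γ⁻¹ v) := by simpa using (hinv γ⁻¹ v).symm
    rw [hv', ← map_mul, hx' _ (hstab _ _ hv), map_zero]
  · rintro x ⟨_, hx'⟩ y ⟨hy, _⟩
    exact hx' y hy

end Semiprime

/-! ### Characters of a finite abelian group -/

section CharacterSums

variable {k G : Type*} [Field k] [IsAlgClosed k] [CharZero k] [CommGroup G] [Finite G]

theorem finite_characters : Finite (G →* kˣ) := by
  have : NeZero ((Monoid.exponent G : ℕ) : k) := ⟨by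
    exact_mod_cast Monoid.exponent_ne_zero_of_finite⟩
  infer_instance

/-- Translation by a character `ψ` with `ψ g ≠ 1` multiplies the sum by `ψ g`. Such a character
exists because `k` has enough roots of unity. -/
theorem sum_characters_eq_zero [Fintype (G →* kˣ)] {g : G} (hg : g ≠ 1) :
    ∑ ψ : G →* kˣ, (ψ g : k) = 0 := by
  have : NeZero ((Monoid.exponent G : ℕ) : k) := ⟨by
    exact_mod_cast Monoid.exponent_ne_zero_of_finite⟩
  obtain ⟨ψ, hψ⟩ := CommGroup.exists_apply_ne_one_of_hasEnoughRootsOfUnity G k hg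
  have h : (ψ g : k) * ∑ ψ : G →* kˣ, (ψ g : k) = ∑ ψ : G →* kˣ, (ψ g : k) := by
    rw [Finset.mul_sum]
    exact Fintype.sum_equiv (Equiv.mulLeft ψ) _ _ fun ψ' => by simp
  have h1 : (ψ g : k) - 1 ≠ 0 := fun h => hψ (Units.ext (by simpa using sub_eq_zero.1 h))
  refine (mul_eq_zero.1 ?_).resolve_left h1
  rw [sub_mul, h, one_mul, sub_self]

end CharacterSums

/-! ### Monomials in the bosonization -/

noncomputable section

namespace QLSDatum.Boson

variable {k G : Type*} [Field k] [CommGroup G] {θ : ℕ} (D : QLSDatum k G θ)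

/-- The product of the generators `xᵢ` along a word in the indices. -/
def word (w : List (Fin θ)) : D.Boson := (w.map (x D)).prod

@[simp] theorem word_nil : word D [] = 1 := rfl

@[simp] theorem word_cons (i : Fin θ) (w : List (Fin θ)) :
    word D (i :: w) = x D i * word D w := by simp [word]

@[simp] theorem word_append (v w : List (Fin θ)) :
    word D (v ++ w) = word D v * word D w := by simp [word]

@[simp] theorem word_replicate (n : ℕ) (i : Fin θ) :
    word D (List.replicate n i) = x D i ^ n := by simp [word]

/-- Exchanging neighbouring letters costs a value of a character, so up to a nonzero scalar a
monomial depends only on the multiplicities of its letters. -/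
theorem exists_smul_word_of_perm {v w : List (Fin θ)} (h : v.Perm w) :
    ∃ c : k, c ≠ 0 ∧ word D v = c • word D w := by
  induction h with
  | nil => exact ⟨1, one_ne_zero, by simp⟩
  | cons i _ ih =>
    obtain ⟨c, hc, h⟩ := ih
    exact ⟨c, hc, by rw [word_cons, word_cons, h, mul_smul_comm]⟩
  | swap i j w =>
    rcases eq_or_ne j i with rfl | hij
    · exact ⟨1, one_ne_zero, by simp⟩
    · refine ⟨D.χ i (D.g j), Units.ne_zero _, ?_⟩
      simp only [word_cons]
      rw [← mul_assoc, x_mul_x D j i hij, smul_mul_assoc, mul_assoc]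
  | trans _ _ ih1 ih2 =>
    obtain ⟨c, hc, h⟩ := ih1
    obtain ⟨d, hd, h'⟩ := ih2
    exact ⟨c * d, mul_ne_zero hc hd, by rw [h, h', smul_smul]⟩

theorem word_eq_zero {w : List (Fin θ)} {i : Fin θ} (h : D.m i ≤ w.count i) : word D w = 0 := by
  have hs : (List.replicate (D.m i) i).Subperm w := by
    rw [List.subperm_ext_iff]
    intro j hj
    rw [List.eq_of_mem_replicate hj, List.count_replicate_self]
    exact h
  obtain ⟨c, -, hc⟩ := exists_smul_word_of_perm D (List.subperm_append_diff_self_of_count_le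
    (List.subperm_ext_iff.1 hs)).symm
  rw [hc, word_append, word_replicate, x_pow, zero_mul, smul_zero]

theorem grp_mul_word (a : G) (w : List (Fin θ)) :
    ∃ c : k, c ≠ 0 ∧ grp D a * word D w = c • (word D w * grp D a) := by
  induction w with
  | nil => exact ⟨1, one_ne_zero, by simp⟩
  | cons i w ih =>
    obtain ⟨c, hc, h⟩ := ih
    refine ⟨D.χ i a * c, mul_ne_zero (Units.ne_zero _) hc, ?_⟩
    rw [word_cons, ← mul_assoc, grp_mul_x, smul_mul_assoc, mul_assoc, h, mul_smul_comm, smul_smul,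
      mul_assoc]

/-- The right ideal generated by a monomial is two-sided. Consequently the image of a monomial
acting on a `B`-module is a submodule. -/
theorem exists_mul_word (w : List (Fin θ)) (b : D.Boson) : ∃ b', b * word D w = word D w * b' := by
  induction b using induction D with
  | hgrp a =>
    obtain ⟨c, -, h⟩ := grp_mul_word D a w
    exact ⟨c • grp D a, by rw [h, mul_smul_comm]⟩
  | hx i =>
    obtain ⟨c, -, h⟩ := exists_smul_word_of_perm D (List.perm_append_singleton i w).symm
    refine ⟨c • x D i, ?_⟩
    rw [← word_cons, h, word_append, mul_smul_comm, word_cons, word_nil, mul_one]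
  | hc c => exact ⟨algebraMap k _ c, Algebra.commutes c _⟩
  | hadd a b ha hb =>
    obtain ⟨a', ha⟩ := ha
    obtain ⟨b', hb⟩ := hb
    exact ⟨a' + b', by rw [add_mul, mul_add, ha, hb]⟩
  | hmul a b ha hb =>
    obtain ⟨a', ha⟩ := ha
    obtain ⟨b', hb⟩ := hb
    exact ⟨a' * b', by rw [mul_assoc, hb, ← mul_assoc, ha, mul_assoc]⟩

/-- The word in which every index `i` occurs `mᵢ - 1` times. -/
def topWord : List (Fin θ) := (List.finRange θ).flatMap fun i => List.replicate (D.m i - 1) i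

theorem count_flatMap_replicate {ι : Type*} [DecidableEq ι] (n : ι → ℕ) (l : List ι)
    (hl : l.Nodup) (i : ι) :
    (l.flatMap fun i => List.replicate (n i) i).count i = if i ∈ l then n i else 0 := by
  induction l with
  | nil => simp
  | cons j l ih =>
    rw [List.nodup_cons] at hl
    rw [List.flatMap_cons, List.count_append, ih hl.2, List.count_replicate]
    by_cases hij : j = i
    · subst hij; simp [hl.1]
    · simp [hij, Ne.symm hij]

theorem count_topWord (i : Fin θ) : (topWord D).count i = D.m i - 1 := by
  rw [topWord, count_flatMap_replicate _ _ (List.nodup_finRange θ)]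
  simp

/-- The product `x₁ ^ (m₁ - 1) ⋯ x_θ ^ (m_θ - 1)`. -/
def top : D.Boson := word D (topWord D)

theorem x_mul_top (i : Fin θ) : x D i * top D = 0 := by
  rw [top, ← word_cons]
  apply word_eq_zero D (i := i)
  rw [List.count_cons_self, count_topWord]
  omega

theorem word_ne_zero_imp {w : List (Fin θ)} (h : word D w ≠ 0) (i : Fin θ) :
    w.count i ≤ (topWord D).count i := by
  by_contra hlt
  rw [count_topWord] at hlt
  exact h (word_eq_zero D (i := i) (by omega))

/-! The lowering representation. -/

/-- The scalars of the operators `xᵢ` in the lowering representation. -/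
def lowerCoeff (i : Fin θ) (α : Fin θ → ℕ) : kˣ :=
  ∏ j ∈ Finset.univ.filter (· < i), D.χ i (D.g j) ^ α j

theorem lowerCoeff_add_of_lt {i j : Fin θ} (h : j < i) (α : Fin θ → ℕ) :
    lowerCoeff D i (α + Pi.single j 1) = D.χ i (D.g j) * lowerCoeff D i α := by
  rw [lowerCoeff, lowerCoeff]
  have hj : j ∈ Finset.univ.filter (· < i) := by simp [h]
  rw [← Finset.mul_prod_erase _ _ hj, ← Finset.mul_prod_erase _ (fun l => D.χ i (D.g l) ^ α l) hj]
  rw [Pi.add_apply, Pi.single_eq_same, pow_succ', mul_assoc]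
  congr 2
  refine Finset.prod_congr rfl fun l hl => ?_
  rw [Pi.add_apply, Pi.single_eq_of_ne (Finset.ne_of_mem_erase hl), add_zero]

theorem lowerCoeff_add_of_le {i j : Fin θ} (h : i ≤ j) (α : Fin θ → ℕ) :
    lowerCoeff D i (α + Pi.single j 1) = lowerCoeff D i α := by
  refine Finset.prod_congr rfl fun l hl => ?_
  have : l ≠ j := ((Finset.mem_filter.1 hl).2.trans_le h).ne
  rw [Pi.add_apply, Pi.single_eq_of_ne this, add_zero]

/-- The operator of `xᵢ` in the lowering representation. -/
def lower (i : Fin θ) : Module.End k ((Fin θ → ℕ) → k) where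
  toFun f α := if α i + 1 < D.m i then (lowerCoeff D i α : k) * f (α + Pi.single i 1) else 0
  map_add' f f' := by ext α; simp only [Pi.add_apply]; split_ifs <;> simp [mul_add]
  map_smul' c f := by ext α; simp [mul_left_comm]

theorem lower_apply (i : Fin θ) (f : (Fin θ → ℕ) → k) (α : Fin θ → ℕ) : lower D i f α =
    if α i + 1 < D.m i then (lowerCoeff D i α : k) * f (α + Pi.single i 1) else 0 := rfl

/-- The operators of `G` in the lowering representation. -/
def lowerGrp : G →* Module.End k ((Fin θ → ℕ) → k) where
  toFun a :=
    { toFun := fun f α => ((∏ i, D.χ i a⁻¹ ^ α i : kˣ) : k) * f α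
      map_add' := fun f f' => by ext α; simp [mul_add]
      map_smul' := fun c f => by ext α; simp [mul_left_comm] }
  map_one' := by ext f α; simp
  map_mul' a b := by
    ext f α
    simp [mul_pow, Finset.prod_mul_distrib, mul_left_comm, mul_comm]

theorem lowerGrp_apply (a : G) (f : (Fin θ → ℕ) → k) (α : Fin θ → ℕ) :
    lowerGrp D a f α = ((∏ i, D.χ i a⁻¹ ^ α i : kˣ) : k) * f α := rfl

theorem lower_pow_apply (i : Fin θ) (n : ℕ) (f : (Fin θ → ℕ) → k) (α : Fin θ → ℕ)
    (h : D.m i ≤ α i + n) (hn : n ≠ 0) : (lower D i ^ n) f α = 0 := by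
  induction n generalizing α with
  | zero => exact absurd rfl hn
  | succ n ih =>
    rw [pow_succ', Module.End.mul_apply, lower_apply]
    split_ifs with hlt
    · rw [ih _ (by simp; omega) (by omega), mul_zero]
    · rfl

/-- The representation of `B(G, g, χ)` on functions on multi-indices in which `xᵢ` lowers the
`i`-th index. -/
def lowerRep : D.Boson →ₐ[k] Module.End k ((Fin θ → ℕ) → k) :=
  lift D (lowerGrp D) (lower D)
    (fun a i => by
      ext f α
      simp only [Module.End.mul_apply, LinearMap.smul_apply, Pi.smul_apply, lower_apply,
        lowerGrp_apply, smul_eq_mul]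
      split_ifs
      · have : (∏ j, D.χ j a⁻¹ ^ α j : kˣ) =
            D.χ i a * ∏ j, D.χ j a⁻¹ ^ (α + Pi.single i 1 : Fin θ → ℕ) j := by
          simp only [Pi.add_apply, pow_add, Finset.prod_mul_distrib]
          rw [Finset.prod_eq_single (f := fun j => D.χ j a⁻¹ ^ (Pi.single i 1 : Fin θ → ℕ) j) i]
          · rw [Pi.single_eq_same, pow_one, mul_left_comm, ← map_mul, mul_inv_cancel, map_one,
              mul_one]
          · intro j _ hj
            rw [Pi.single_eq_of_ne hj, pow_zero]
          · simp
        rw [this, Units.val_mul]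
        ring
      · simp)
    (fun i => by
      ext f α
      rw [lower_pow_apply D i _ _ _ (by omega) (m_ne_zero D i)]
      rfl)
    (fun i j hij => by
      ext f α
      simp only [Module.End.mul_apply, LinearMap.smul_apply, Pi.smul_apply, lower_apply,
        smul_eq_mul, Pi.add_apply, Pi.single_eq_of_ne hij, Pi.single_eq_of_ne hij.symm, add_zero]
      rw [add_right_comm α]
      split_ifs
      -- Only the coefficient of the larger index sees the shift in the smaller one. If `i < j` this
      -- produces `χⱼ(gᵢ)` itself, otherwise its inverse `χᵢ(gⱼ)`.
      · rcases lt_or_gt_of_ne hij with h | h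
        · rw [lowerCoeff_add_of_lt D h, lowerCoeff_add_of_le D h.le, Units.val_mul]
          ring
        · rw [lowerCoeff_add_of_lt D h, lowerCoeff_add_of_le D h.le, Units.val_mul]
          linear_combination (-(lowerCoeff D i α : k) * lowerCoeff D j α *
            f (α + Pi.single j 1 + Pi.single i 1)) * braid_coe D i j hij
      all_goals simp)

/-- Each letter shifts the point of evaluation by one. As the final point lies inside the box `αᵢ <
mᵢ`, no step leaves it and every coefficient met is a unit. -/
theorem lowerRep_word (w : List (Fin θ)) (f : (Fin θ → ℕ) → k) (α : Fin θ → ℕ)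
    (hw : ∀ i, α i + w.count i < D.m i) :
    ∃ c : k, c ≠ 0 ∧ lowerRep D (word D w) f α = c * f (fun i => α i + w.count i) := by
  induction w generalizing α with
  | nil => exact ⟨1, one_ne_zero, by simp⟩
  | cons i w ih =>
    have hα : ∀ j, (α + Pi.single i 1 : Fin θ → ℕ) j + w.count j = α j + (i :: w).count j := by
      intro j
      rcases eq_or_ne j i with rfl | hj
      · simp; omega
      · simp [hj.symm]
    obtain ⟨c, hc, h⟩ := ih (α + Pi.single i 1) fun j => by rw [hα]; exact hw j
    refine ⟨lowerCoeff D i α * c, mul_ne_zero (Units.ne_zero _) hc, ?_⟩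
    rw [word_cons, map_mul, Module.End.mul_apply, lowerRep, lift_x, lower_apply, if_pos, ← lowerRep,
      h, mul_assoc]
    · simp only [hα]
    · have := hw i
      rw [List.count_cons_self] at this
      omega

/-- In the lowering representation `Λ` takes the constant function `1` to a function that is nonzero
at the origin. -/
theorem top_ne_zero : top D ≠ 0 := by
  intro h
  obtain ⟨c, hc, h'⟩ := lowerRep_word D (topWord D) (fun _ => 1) 0 (fun i => by
    have := m_ne_zero D i
    rw [count_topWord, Pi.zero_apply]
    omega)
  rw [← top, h, map_zero] at h'
  exact hc (by simpa using h'.symm)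

/-- The elements `x_{i₁} ⋯ x_{iₙ} a` with `a ∈ G` span `B(G, g, χ)`. -/
theorem span_word_mul_grp :
    Submodule.span k (Set.range fun p : List (Fin θ) × G => word D p.1 * grp D p.2) = ⊤ := by
  set Z := Submodule.span k (Set.range fun p : List (Fin θ) × G => word D p.1 * grp D p.2)
  have hmem : ∀ w a, word D w * grp D a ∈ Z := fun w a => Submodule.subset_span ⟨(w, a), rfl⟩
  suffices h : ∀ b : D.Boson, Z ≤ Z.comap (LinearMap.mulLeft k b) by
    rw [eq_top_iff]
    intro b _
    have := h b (show (1 : D.Boson) ∈ Z by simpa using hmem [] 1)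
    simpa using this
  intro b
  induction b using induction D with
  | hgrp a =>
    refine Submodule.span_le.2 ?_
    rintro _ ⟨⟨w, c⟩, rfl⟩
    obtain ⟨d, -, h⟩ := grp_mul_word D a w
    change grp D a * (word D w * grp D c) ∈ Z
    rw [← mul_assoc, h, smul_mul_assoc, mul_assoc, ← map_mul]
    exact Z.smul_mem _ (hmem _ _)
  | hx i =>
    refine Submodule.span_le.2 ?_
    rintro _ ⟨⟨w, c⟩, rfl⟩
    change x D i * (word D w * grp D c) ∈ Z
    rw [← mul_assoc, ← word_cons]
    exact hmem _ _
  | hc c =>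
    intro z hz
    rw [Submodule.mem_comap, LinearMap.mulLeft_apply, ← Algebra.smul_def]
    exact Z.smul_mem c hz
  | hadd a b ha hb =>
    intro z hz
    rw [Submodule.mem_comap, LinearMap.mulLeft_apply, add_mul]
    exact Z.add_mem (ha hz) (hb hz)
  | hmul a b ha hb =>
    intro z hz
    rw [Submodule.mem_comap, LinearMap.mulLeft_apply, mul_assoc]
    exact ha (hb hz)

end QLSDatum.Boson

end

/-! ### Skew derivations on a module algebra -/

noncomputable section

/-- This is the coefficient of the one surviving term in the descent of powers; as a `q`-integer it
is nonzero below the order of `q`. -/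
theorem gaussBinom_succ_self {k : Type*} [Field k] (q : k) (n : ℕ) :
    gaussBinom q (n + 1) n = qInt q (n + 1) := by
  induction n with
  | zero => simp [gaussBinom, qInt]
  | succ n ih => rw [gaussBinom_succ, ih, gaussBinom_self, mul_one, qInt_succ' q (n + 1)]

namespace QLSDatum

open Boson

variable {k G : Type*} [Field k] [CommGroup G] {θ : ℕ} (D : QLSDatum k G θ)

section ModuleAlgebra

variable {R : Type*} [Ring R] [Module D.Boson R]

theorem grp_smul_grp_inv_smul (a : G) (r : R) : grp D a • grp D a⁻¹ • r = r := by
  rw [smul_smul, ← map_mul, mul_inv_cancel, map_one, one_smul]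

theorem length_le_of_word_ne_zero {w : List (Fin θ)} (h : word D w ≠ 0) :
    w.length ≤ (topWord D).length :=
  (List.subperm_ext_iff.2 fun i _ => word_ne_zero_imp D h i).length_le

/-- The joint nilpotency of the `xᵢ` as an induction principle. -/
theorem x_induction {U : Set R} (hU : ∀ i, ∀ u ∈ U, x D i • u ∈ U) {P : R → Prop} (h0 : P 0)
    (h : ∀ u ∈ U, (∀ i, P (x D i • u)) → P u) {u : R} (hu : u ∈ U) : P u := by
  have key : ∀ n : ℕ, ∀ u ∈ U, (∀ w : List (Fin θ), w.length = n → P (word D w • u)) → P u := by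
    intro n
    induction n with
    | zero => intro u _ hw; simpa using hw [] rfl
    | succ n ih =>
      intro u hu hw
      refine h u hu fun i => ih _ (hU i u hu) fun w hl => ?_
      have := hw (w ++ [i]) (by simp [hl])
      rwa [word_append, word_cons, word_nil, mul_one, mul_smul] at this
  -- Any monomial longer than `Λ` vanishes, so the induction may start at this length.
  refine key ((topWord D).length + 1) u hu fun w hw => ?_
  have : word D w = 0 := by
    by_contra hne
    have := length_le_of_word_ne_zero D hne
    omega
  rwa [this, zero_smul]

theorem x_smul_mem_image_pow {T : Set R} (hTB : ∀ b : D.Boson, ∀ t ∈ T, b • t ∈ T) (i : Fin θ)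
    (n : ℕ) (l : Fin θ) : ∀ u ∈ (x D i ^ n • ·) '' T, x D l • u ∈ (x D i ^ n • ·) '' T := by
  rintro _ ⟨t, ht, rfl⟩
  obtain ⟨b, hb⟩ := exists_mul_word D (List.replicate n i) (x D l)
  rw [word_replicate] at hb
  exact ⟨b • t, hTB b t ht, by simp only [smul_smul, hb]⟩

variable [Algebra k R] [IsScalarTower k D.Boson R]

theorem x_smul_grp_smul_eq_zero (a : G) {i : Fin θ} {r : R} (h : x D i • r = 0) :
    x D i • grp D a • r = 0 := by
  rw [smul_smul, grp_inv_mul_x, smul_assoc, mul_smul, h, smul_zero, smul_zero]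

theorem x_smul_x_smul_eq_zero {i : Fin θ} (j : Fin θ) {r : R} (h : x D i • r = 0) :
    x D i • x D j • r = 0 := by
  rcases eq_or_ne i j with rfl | hij
  · rw [h, smul_zero]
  · rw [smul_smul, x_mul_x D i j hij, smul_assoc, mul_smul, h, smul_zero, smul_zero]

variable [IsModuleAlgebra k R D.Boson]

theorem grp_smul_mul (a : G) (r s : R) : grp D a • (r * s) = (grp D a • r) * (grp D a • s) := by
  rw [IsModuleAlgebra.smul_mul' (k := k), comul_grp]
  simp

theorem x_smul_mul (i : Fin θ) (r s : R) :
    x D i • (r * s) = (grp D (D.g i) • r) * (x D i • s) + (x D i • r) * s := by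
  rw [IsModuleAlgebra.smul_mul' (k := k), comul_x]
  simp

theorem x_smul_mul_of_right {i : Fin θ} {s : R} (hs : x D i • s = 0) (r : R) :
    x D i • (r * s) = (x D i • r) * s := by
  rw [x_smul_mul, hs, mul_zero, zero_add]

theorem x_smul_mul_of_left {i : Fin θ} {r : R} (hr : x D i • r = 0) (s : R) :
    x D i • (r * s) = (grp D (D.g i) • r) * (x D i • s) := by
  rw [x_smul_mul, hr, zero_mul, add_zero]

/-- The degree in `G` of a word in the `xᵢ`. -/
def wordDeg (w : List (Fin θ)) : G := (w.map D.g).prod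

/-- If `xᵢ` kills `c`, the skew Leibniz rule leaves only `(gᵢ · c)(xᵢ · r)`, and every `xⱼ` that
kills `c` also kills `gᵢ · c`. -/
theorem word_smul_mul_of_left {w : List (Fin θ)} {c : R} (hc : ∀ i ∈ w, x D i • c = 0) (r : R) :
    word D w • (c * r) = (grp D (wordDeg D w) • c) * (word D w • r) := by
  induction w with
  | nil => simp [wordDeg]
  | cons i w ih =>
    rw [word_cons, mul_smul, ih fun j hj => hc j (List.mem_cons_of_mem _ hj), x_smul_mul_of_left D
      (x_smul_grp_smul_eq_zero D _ (hc i List.mem_cons_self)), smul_smul, ← map_mul, mul_smul]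
    rfl

/-- Makes the image of a monomial stable under left multiplication by elements that its letters
kill. -/
theorem mul_word_smul {w : List (Fin θ)} {c : R} (hc : ∀ i ∈ w, x D i • c = 0) (r : R) :
    c * (word D w • r) = word D w • ((grp D (wordDeg D w)⁻¹ • c) * r) := by
  rw [word_smul_mul_of_left D fun i hi => x_smul_grp_smul_eq_zero D _ (hc i hi),
    grp_smul_grp_inv_smul]

theorem word_smul_mul_of_right {w : List (Fin θ)} {c : R} (hc : ∀ i ∈ w, x D i • c = 0) (r : R) :
    word D w • (r * c) = (word D w • r) * c := by
  induction w with
  | nil => simp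
  | cons i w ih =>
    rw [word_cons, mul_smul, ih fun j hj => hc j (List.mem_cons_of_mem _ hj),
      x_smul_mul_of_right D (hc i List.mem_cons_self), mul_smul]

/-- The two summands `xᵢ ⊗ 1` and `gᵢ ⊗ xᵢ` of the comultiplication `q`-commute with `q = χᵢ(gᵢ)`,
so the `q`-binomial formula expands its powers. -/
theorem x_pow_smul_mul (i : Fin θ) (n : ℕ) (a c : R) :
    x D i ^ n • (a * c) = ∑ j ∈ Finset.range (n + 1), gaussBinom (D.χ i (D.g i) : k) n j •
      (((x D i ^ j * grp D (D.g i) ^ (n - j)) • a) * (x D i ^ (n - j) • c)) := by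
  rw [IsModuleAlgebra.smul_mul' (k := k), Bialgebra.comul_pow, comul_x, add_comm,
    add_pow_gaussBinom (D.χ i (D.g i) : k)]
  · rw [map_sum, map_sum]
    refine Finset.sum_congr rfl fun j _ => ?_
    rw [map_smul, map_smul, Algebra.TensorProduct.tmul_pow, Algebra.TensorProduct.tmul_pow,
      Algebra.TensorProduct.tmul_mul_tmul, TensorProduct.map_tmul, LinearMap.mul'_apply,
      orbitMap_apply, orbitMap_apply, one_pow, one_mul]
  · simp [Algebra.TensorProduct.tmul_mul_tmul, grp_mul_x, TensorProduct.smul_tmul']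

end ModuleAlgebra

/-! ### Stripping the letters of `Λ` -/

section Descent

variable {R : Type*} [Ring R] [Algebra k R] [Module D.Boson R] [IsScalarTower k D.Boson R]

/-- `J` is a two-sided `G`-stable ideal of the algebra of elements killed by all `xᵢ`, except that
it need not be closed under addition. -/
structure IsInvariantIdeal (J : Set R) : Prop where
  x_smul : ∀ j ∈ J, ∀ i, x D i • j = 0
  mul_mem : ∀ c : R, (∀ i, x D i • c = 0) → ∀ j ∈ J, c * j ∈ J
  mul_mem_right : ∀ c : R, (∀ i, x D i • c = 0) → ∀ j ∈ J, j * c ∈ J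
  grp_smul : ∀ a, ∀ j ∈ J, grp D a • j ∈ J

/-- No nonzero element `c` of the algebra `C` of elements killed by all `xᵢ` has `c C c = 0`. -/
def SemiprimeInvariants (R : Type*) [Ring R] [Algebra k R] [Module D.Boson R] : Prop :=
  ∀ c : R, (∀ i, x D i • c = 0) → (∀ d : R, (∀ i, x D i • d = 0) → c * d * c = 0) → c = 0

variable [IsModuleAlgebra k R D.Boson] {D}

theorem x_smul_mul_eq_zero {i : Fin θ} {c d : R} (hc : x D i • c = 0) (hd : x D i • d = 0) :
    x D i • (c * d) = 0 := by
  rw [x_smul_mul_of_right D hd, hc, zero_mul]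

variable {J U : Set R}

/-- By joint nilpotency of the `xᵢ` one may assume that all `xᵢ · v` annihilate `J`; then `v j` lies
in `C`. Now `(j v j') d (j v j') = j v · (j' d j) v · j' = 0` for `d ∈ C`, so `j v j' = 0`, and
hence `(v j) d (v j) = 0` as well. Semiprimeness of `C` is used both times. -/
theorem mul_eq_zero_right_of_sq (hC : SemiprimeInvariants D R) (hJ : IsInvariantIdeal D J)
    (hUx : ∀ i, ∀ u ∈ U, x D i • u ∈ U)
    (hUC : ∀ c : R, (∀ i, x D i • c = 0) → ∀ u ∈ U, c * u ∈ U)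
    (hsq : ∀ j ∈ J, ∀ u ∈ U, ∀ v ∈ U, ∀ j' ∈ J, j * u * (v * j') = 0)
    {u j : R} (hu : u ∈ U) (hj : j ∈ J) : u * j = 0 := by
  refine x_induction D hUx (P := fun u => ∀ j ∈ J, u * j = 0) (by simp) ?_ hu j hj
  intro v hv hxv
  have hvJ : ∀ j ∈ J, ∀ i, x D i • (v * j) = 0 := fun j hj i => by
    rw [x_smul_mul_of_right D (hJ.x_smul j hj i), hxv i j hj]
  have h1 : ∀ j ∈ J, ∀ j' ∈ J, j * (v * j') = 0 := by
    intro j hj j' hj'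
    refine hC _ (fun i => x_smul_mul_eq_zero (hJ.x_smul j hj i) (hvJ j' hj' i)) fun d hd => ?_
    have hcd : ∀ i, x D i • (j' * d * j) = 0 :=
      hJ.x_smul _ (hJ.mul_mem _ (hJ.x_smul _ (hJ.mul_mem_right d hd j' hj')) j hj)
    have := hsq j hj v hv _ (hUC _ hcd v hv) j' hj'
    simpa only [mul_assoc] using this
  intro j hj
  refine hC _ (hvJ j hj) fun d hd => ?_
  have := h1 _ (hJ.mul_mem_right d hd j hj) j hj
  rw [mul_assoc v, mul_assoc v, this, mul_zero]

/-- The mirror image of the previous argument. Passing `xᵢ` over `j` twists it by `gᵢ`, which is why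
`J` must be `G`-stable. -/
theorem mul_eq_zero_left_of_sq (hC : SemiprimeInvariants D R) (hJ : IsInvariantIdeal D J)
    (hUx : ∀ i, ∀ u ∈ U, x D i • u ∈ U)
    (hUC : ∀ c : R, (∀ i, x D i • c = 0) → ∀ u ∈ U, c * u ∈ U)
    (hsq : ∀ j ∈ J, ∀ u ∈ U, ∀ v ∈ U, ∀ j' ∈ J, j * u * (v * j') = 0)
    {u j : R} (hu : u ∈ U) (hj : j ∈ J) : j * u = 0 := by
  refine x_induction D hUx (P := fun u => ∀ j ∈ J, j * u = 0) (by simp) ?_ hu j hj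
  intro v hv hxv
  have hvJ : ∀ j ∈ J, ∀ i, x D i • (j * v) = 0 := fun j hj i => by
    rw [x_smul_mul_of_left D (hJ.x_smul j hj i), hxv i _ (hJ.grp_smul _ j hj)]
  have h1 : ∀ j ∈ J, ∀ j' ∈ J, j * v * j' = 0 := by
    intro j hj j' hj'
    refine hC _ (fun i => x_smul_mul_eq_zero (hvJ j hj i) (hJ.x_smul j' hj' i)) fun d hd => ?_
    have hcd : ∀ i, x D i • (j' * d * j) = 0 :=
      hJ.x_smul _ (hJ.mul_mem _ (hJ.x_smul _ (hJ.mul_mem_right d hd j' hj')) j hj)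
    have := hsq j hj v hv _ (hUC _ hcd v hv) j' hj'
    simpa only [mul_assoc] using this
  intro j hj
  refine hC _ (hvJ j hj) fun d hd => ?_
  have := h1 j hj _ (hJ.mul_mem d hd j hj)
  rw [mul_assoc, ← mul_assoc d, ← mul_assoc, this, zero_mul]

theorem mul_eq_zero_comm (hC : SemiprimeInvariants D R) (hJ : IsInvariantIdeal D J)
    (hUx : ∀ i, ∀ u ∈ U, x D i • u ∈ U)
    (hUC : ∀ c : R, (∀ i, x D i • c = 0) → ∀ u ∈ U, c * u ∈ U)
    (h : ∀ u ∈ U, ∀ j ∈ J, u * j = 0) {u j : R} (hu : u ∈ U) (hj : j ∈ J) : j * u = 0 :=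
  mul_eq_zero_left_of_sq hC hJ hUx hUC (fun _ _ _ _ v hv j' hj' => by rw [h v hv j' hj', mul_zero])
    hu hj

section Power

variable {T : Set R} (hTB : ∀ b : D.Boson, ∀ t ∈ T, b • t ∈ T)
  (hTC : ∀ c : R, (∀ i, x D i • c = 0) → ∀ t ∈ T, c * t ∈ T)

include hTC in
theorem mul_mem_image_pow (i : Fin θ) (n : ℕ) (c : R) (hc : ∀ i, x D i • c = 0) :
    ∀ u ∈ (x D i ^ n • ·) '' T, c * u ∈ (x D i ^ n • ·) '' T := by
  rintro _ ⟨t, ht, rfl⟩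
  refine ⟨_, hTC (grp D (wordDeg D (List.replicate n i))⁻¹ • c)
    (fun l => x_smul_grp_smul_eq_zero D _ (hc l)) t ht, ?_⟩
  have := mul_word_smul D (w := List.replicate n i) (fun l _ => hc l) t
  rw [word_replicate] at this
  exact this.symm

-- With `U = x ^ (n + 1) · T`, the hypothesis on `x ^ (n + 2)` implies `J U U J = 0`: apply `x ^ (n
-- + 2)` to a product and expand. Semiprimeness of `C` then gives `U J = 0`.
include hTB hTC in
theorem pow_smul_mul_eq_zero_of_succ (hC : SemiprimeInvariants D R) (hJ : IsInvariantIdeal D J)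
    (hTm : ∀ s ∈ T, ∀ t ∈ T, s * t ∈ T) (i : Fin θ) (n : ℕ) (hn : n + 2 < D.m i)
    (h : ∀ t ∈ T, ∀ j ∈ J, (x D i ^ (n + 2) • t) * j = 0) :
    ∀ t ∈ T, ∀ j ∈ J, (x D i ^ (n + 1) • t) * j = 0 := by
  have hleft : ∀ t ∈ T, ∀ j ∈ J, j * (x D i ^ (n + 2) • t) = 0 := fun t ht j hj =>
    mul_eq_zero_comm hC hJ (U := (x D i ^ (n + 2) • ·) '' T) (x_smul_mem_image_pow D hTB i _)
      (mul_mem_image_pow hTC i _) (by rintro _ ⟨s, hs, rfl⟩ j' hj'; exact h s hs j' hj')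
      ⟨t, ht, rfl⟩ hj
  refine fun t ht j hj => mul_eq_zero_right_of_sq hC hJ (U := (x D i ^ (n + 1) • ·) '' T)
    (x_smul_mem_image_pow D hTB i _) (mul_mem_image_pow hTC i _) ?_ ⟨t, ht, rfl⟩ hj
  rintro j hj _ ⟨a, ha, rfl⟩ _ ⟨b, hb, rfl⟩ j' hj'
  -- The twist by `gᵢ⁻¹` cancels the single `gᵢ` in the term of index `n + 1`, which becomes `(x ^
  -- (n + 1) · a)(x ^ (n + 1) · b)`.
  have hmem : (grp D (D.g i)⁻¹ • a) * (x D i ^ n • b) ∈ T := hTm _ (hTB _ a ha) _ (hTB _ b hb)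
  have e := h _ hmem j' hj'
  rw [x_pow_smul_mul, Finset.sum_mul] at e
  replace e := congrArg (j * ·) e
  simp only [Finset.mul_sum, mul_zero] at e
  rw [Finset.sum_eq_single_of_mem (n + 1) (by simp)] at e
  · rw [gaussBinom_succ_self, show n + 2 - (n + 1) = 1 by omega, pow_one, pow_one, mul_smul,
      grp_smul_grp_inv_smul, smul_smul (x D i), ← pow_succ', smul_mul_assoc, mul_smul_comm] at e
    have hq : qInt (D.χ i (D.g i) : k) (n + 1 + 1) ≠ 0 :=
      qInt_ne_zero _ _ (by omega) (by rw [orderOf_units]; exact hn)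
    have := (smul_eq_zero_iff_right hq).1 e
    simpa only [mul_assoc] using this
  · intro p hp hpn
    rw [Finset.mem_range] at hp
    rw [smul_mul_assoc, mul_smul_comm]
    -- For smaller `p` the right factor lies in `x ^ (n + 2) · T` and is killed by `j'`; for `p = n
    -- + 2` the left factor lies there and is killed by `j`.
    rcases Nat.lt_or_ge p (n + 1) with hlt | hge
    · have : x D i ^ (n + 2 - p) • x D i ^ n • b = x D i ^ (n + 2) • x D i ^ (n - p) • b := by
        rw [smul_smul, smul_smul, ← pow_add, ← pow_add]
        congr 2
        omega
      rw [this, mul_assoc, h _ (hTB _ b hb) j' hj', mul_zero, mul_zero, smul_zero]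
    · obtain rfl : p = n + 2 := by omega
      rw [Nat.sub_self, pow_zero, mul_one, ← mul_assoc, ← mul_assoc, hleft _ (hTB _ a ha) j hj,
        zero_mul, zero_mul, smul_zero]

include hTB hTC in
theorem x_smul_mul_eq_zero_of_pow (hC : SemiprimeInvariants D R) (hJ : IsInvariantIdeal D J)
    (hTm : ∀ s ∈ T, ∀ t ∈ T, s * t ∈ T) (i : Fin θ)
    (h : ∀ t ∈ T, ∀ j ∈ J, (x D i ^ (D.m i - 1) • t) * j = 0) :
    ∀ t ∈ T, ∀ j ∈ J, (x D i • t) * j = 0 := by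
  have key : ∀ n, n + 1 < D.m i → (∀ t ∈ T, ∀ j ∈ J, (x D i ^ (n + 1) • t) * j = 0) →
      ∀ t ∈ T, ∀ j ∈ J, (x D i • t) * j = 0 := by
    intro n
    induction n with
    | zero => intro _ h; simpa using h
    | succ n ih =>
      exact fun hn h => ih (by omega) (pow_smul_mul_eq_zero_of_succ hTB hTC hC hJ hTm i n hn h)
  have hm : 2 ≤ D.m i := D.two_le_orderOf i
  exact key (D.m i - 2) (by omega) (by rwa [show D.m i - 2 + 1 = D.m i - 1 by omega])

end Power

/-- The elementwise form of the conditions on left ideals: for each `i`, the algebra of elements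
killed by `x_{σ j}` for all `j > i` has no nonzero left ideal killed by `x_{σ i}`. -/
def NoKilledIdeals (D : QLSDatum k G θ) (R : Type*) [Ring R] [Module D.Boson R]
    (σ : Equiv.Perm (Fin θ)) : Prop :=
  ∀ (i : Fin θ) (z : R), (∀ l, i < l → x D (σ l) • z = 0) →
    (∀ s : R, (∀ l, i < l → x D (σ l) • s = 0) → x D (σ i) • (s * z) = 0) → z = 0

variable (D) in
/-- The part of the top word made of the letters `σ i` with `n ≤ i`. -/
def tailWord (σ : Equiv.Perm (Fin θ)) (n : ℕ) : List (Fin θ) :=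
  (((List.finRange θ).drop n).map σ).flatMap fun i => List.replicate (D.m i - 1) i

theorem mem_drop_finRange {n : ℕ} {i : Fin θ} : i ∈ (List.finRange θ).drop n ↔ n ≤ i := by
  rw [List.mem_drop_iff_getElem]
  constructor
  · rintro ⟨m, hm, rfl⟩
    simp
  · intro h
    have := i.2
    exact ⟨i - n, by simp; omega, by ext; simp; omega⟩

variable (D) in
theorem count_tailWord (σ : Equiv.Perm (Fin θ)) (n : ℕ) (i : Fin θ) :
    (tailWord D σ n).count (σ i) = if n ≤ i then D.m (σ i) - 1 else 0 := by
  rw [tailWord, count_flatMap_replicate _ _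
    (((List.nodup_finRange θ).sublist (List.drop_sublist _ _)).map σ.injective)]
  simp only [List.mem_map_of_injective σ.injective, mem_drop_finRange]

theorem le_of_mem_tailWord {σ : Equiv.Perm (Fin θ)} {n : ℕ} {l : Fin θ}
    (h : l ∈ tailWord D σ n) : ∃ i : Fin θ, n ≤ i ∧ σ i = l := by
  refine ⟨σ.symm l, ?_, by simp⟩
  by_contra hlt
  have := count_tailWord D σ n (σ.symm l)
  rw [if_neg hlt, Equiv.apply_symm_apply, List.count_eq_zero] at this
  exact this h

variable (D) in
theorem tailWord_of_lt (σ : Equiv.Perm (Fin θ)) {n : ℕ} (hn : n < θ) : tailWord D σ n =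
    List.replicate (D.m (σ ⟨n, hn⟩) - 1) (σ ⟨n, hn⟩) ++ tailWord D σ (n + 1) := by
  rw [tailWord, List.drop_eq_getElem_cons (by simpa using hn), List.map_cons, List.flatMap_cons,
    tailWord]
  simp

/-- The tail already contains the maximal nonvanishing power of each of its letters. -/
theorem x_mul_tailWord (σ : Equiv.Perm (Fin θ)) {n : ℕ} {i : Fin θ} (h : n ≤ i) :
    x D (σ i) * word D (tailWord D σ n) = 0 := by
  rw [← word_cons]
  apply word_eq_zero D (i := σ i)
  rw [List.count_cons_self, count_tailWord, if_pos h]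
  omega

/-- The letters `σ 0, σ 1, …` are removed from the left of `Λ`. Once `x_{σ n}` annihilates `T J`,
where `T` is the image of the remaining tail, the left ideal of the `n`-th kernel algebra generated
by any element of `T J` is killed by `x_{σ n}`, so `T J = 0`. -/
theorem eq_zero_of_top_smul_mul (hC : SemiprimeInvariants D R) (hJ : IsInvariantIdeal D J)
    {σ : Equiv.Perm (Fin θ)} (hσ : NoKilledIdeals D R σ)
    (h : ∀ r : R, ∀ j ∈ J, (top D • r) * j = 0) : ∀ j ∈ J, j = 0 := by
  have key : ∀ n ≤ θ, ∀ r : R, ∀ j ∈ J, (word D (tailWord D σ n) • r) * j = 0 := by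
    intro n
    induction n with
    | zero =>
      intro _ r j hj
      have hp : (tailWord D σ 0).Perm (topWord D) := by
        rw [List.perm_iff_count]
        intro l
        rw [count_topWord]
        simpa using count_tailWord D σ 0 (σ.symm l)
      obtain ⟨c, -, hc⟩ := exists_smul_word_of_perm D hp
      rw [hc, smul_assoc, smul_mul_assoc, ← top, h r j hj, smul_zero]
    | succ n ih =>
      intro hn
      set i : Fin θ := ⟨n, hn⟩
      set w := tailWord D σ (n + 1)
      set T : Set R := Set.range fun r : R => word D w • r
      have hTB : ∀ b : D.Boson, ∀ t ∈ T, b • t ∈ T := by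
        rintro b _ ⟨r, rfl⟩
        obtain ⟨b', hb⟩ := exists_mul_word D w b
        exact ⟨b' • r, by simp only [smul_smul, hb]⟩
      have hTk : ∀ t ∈ T, ∀ l, i < l → x D (σ l) • t = 0 := by
        rintro _ ⟨r, rfl⟩ l hl
        simp only
        rw [smul_smul, x_mul_tailWord σ (show n + 1 ≤ l from hl), zero_smul]
      -- `T` is a left ideal of the algebra of elements killed by the later letters, which also
      -- contains `T`; this gives closure under products.
      have hTS : ∀ s : R, (∀ l, i < l → x D (σ l) • s = 0) → ∀ t ∈ T, s * t ∈ T := by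
        rintro s hs _ ⟨r, rfl⟩
        refine ⟨_, (mul_word_smul D (fun l hl => ?_) r).symm⟩
        obtain ⟨l', hl', rfl⟩ := le_of_mem_tailWord hl
        exact hs l' hl'
      have hTC : ∀ c : R, (∀ i, x D i • c = 0) → ∀ t ∈ T, c * t ∈ T :=
        fun c hc => hTS c fun l _ => hc _
      have hx := x_smul_mul_eq_zero_of_pow hTB hTC hC hJ (fun s hs => hTS s (hTk s hs)) (σ i) (by
        rintro _ ⟨r, rfl⟩ j hj
        have := ih (by omega) r j hj
        rwa [tailWord_of_lt D σ hn, word_append, word_replicate, mul_smul] at this)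
      intro r j hj
      refine hσ i _ (fun l hl => ?_) fun s hs => ?_
      · rw [x_smul_mul_of_right D (hJ.x_smul j hj _), hTk _ ⟨r, rfl⟩ l hl, zero_mul]
      · rw [← mul_assoc, x_smul_mul_of_right D (hJ.x_smul j hj _),
          hx _ (hTS s hs _ ⟨r, rfl⟩) j hj]
  intro j hj
  have := key θ le_rfl 1 j hj
  rwa [tailWord, List.drop_of_length_le (by simp), List.map_nil, List.flatMap_nil, word_nil,
    one_smul, one_mul] at this

end Descent

end QLSDatum

end

/-! ### The two factors of a smash product -/

noncomputable section

namespace SmashProduct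

variable {k R H : Type*} [CommRing k] [Ring R] [Algebra k R] [Ring H] [Bialgebra k H]
  [Module H R] [IsScalarTower k H R] [IsModuleAlgebra k R H]

omit [IsModuleAlgebra k R H] in
theorem mulMap_tmul_one (r : R) (z : R ⊗[k] H) : mulMap k R H (r ⊗ₜ 1) z = mulL k H r z := by
  rw [mulMap_tmul, map_one, Module.End.one_apply]

omit [IsModuleAlgebra k R H] in
theorem mulMap_tmul_tmul (r s : R) (h h' : H) : mulMap k R H (r ⊗ₜ h) (s ⊗ₜ h') = mulL k H r
    (TensorProduct.map (orbitMap k H s) (LinearMap.mulRight k h') (Coalgebra.comul (R := k) h)) := by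
  rw [mulMap_tmul, diag_tmul]

variable (k H) in
/-- The embedding `r ↦ r # 1`. -/
def inl : R →+* SmashProduct k R H where
  toFun r := mk k r 1
  map_one' := rfl
  map_zero' := TensorProduct.zero_tmul _ _
  map_add' _ _ := TensorProduct.add_tmul _ _ _
  map_mul' r s := (mulMap_tmul_one r (s ⊗ₜ[k] (1 : H))).symm

theorem mk_mul_one_mk (r : R) (h h' : H) : mk k r h * mk k 1 h' = mk k r (h * h') := by
  have h1 : ∀ u : H ⊗[k] H, TensorProduct.map (orbitMap k H (1 : R)) (LinearMap.mulRight k h') u =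
      1 ⊗ₜ (TensorProduct.lid k H (Coalgebra.counit.rTensor H u) * h') := by
    intro u
    induction u using TensorProduct.induction_on with
    | zero => simp
    | add x y hx hy => simp only [map_add, add_mul, TensorProduct.tmul_add, hx, hy]
    | tmul a b =>
      simp [IsModuleAlgebra.smul_one' (k := k) (R := R) a, TensorProduct.smul_tmul]
  change mulMap k R H (r ⊗ₜ h) (1 ⊗ₜ h') = r ⊗ₜ (h * h')
  rw [mulMap_tmul_tmul, h1, Coalgebra.rTensor_counit_comul]
  simp

variable (k R) in
/-- The embedding `h ↦ 1 # h`. -/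
def inr : H →+* SmashProduct k R H where
  toFun h := mk k 1 h
  map_one' := rfl
  map_zero' := TensorProduct.tmul_zero _ _
  map_add' _ _ := TensorProduct.tmul_add _ _ _
  map_mul' _ _ := (mk_mul_one_mk _ _ _).symm

theorem inl_mul_inr (r : R) (h : H) : inl k H r * inr k R h = mk k r h := by
  change mulMap k R H (r ⊗ₜ 1) (1 ⊗ₜ h) = r ⊗ₜ h
  rw [mulMap_tmul_one, mulL_tmul, mul_one]

theorem inr_smul (c : k) (h : H) :
    inr k R (c • h) = inl k H (algebraMap k R c) * inr k R h := by
  rw [inl_mul_inr, Algebra.algebraMap_eq_smul_one, mk, TensorProduct.smul_tmul]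
  rfl

theorem inr_mul_inl (h : H) (r : R) : inr k R h * inl k H r =
    TensorProduct.map (orbitMap k H r) LinearMap.id (Coalgebra.comul (R := k) h) := by
  change mulMap k R H (1 ⊗ₜ h) (r ⊗ₜ 1) = _
  rw [mulMap_tmul_tmul, LinearMap.mulRight_one, mulL, LinearMap.mulLeft_one, LinearMap.rTensor_id,
    LinearMap.id_apply]

theorem add_induction {P : SmashProduct k R H → Prop} (h0 : P 0)
    (hadd : ∀ y z, P y → P z → P (y + z)) (h : ∀ r h, P (inl k H r * inr k R h))
    (z : SmashProduct k R H) : P z := by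
  refine TensorProduct.induction_on z h0 (fun r b => ?_) hadd
  have := h r b
  rwa [inl_mul_inr] at this

section MapRight

variable (f : H →ₐ[k] H) (hf : ∀ h, Coalgebra.comul (R := k) (f h) =
    f.toLinearMap.lTensor H (Coalgebra.comul (R := k) h))

-- Only left tensor legs of the comultiplication act on `R`, while `f`, being left colinear, changes
-- only right legs.
omit [IsModuleAlgebra k R H] in
include hf in
theorem lTensor_mulMap (y z : R ⊗[k] H) : f.toLinearMap.lTensor R (mulMap k R H y z) =
    mulMap k R H (f.toLinearMap.lTensor R y) (f.toLinearMap.lTensor R z) := by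
  have hL : ∀ (r : R) (u : R ⊗[k] H), f.toLinearMap.lTensor R (mulL k H r u) =
      mulL k H r (f.toLinearMap.lTensor R u) := by
    intro r u
    induction u using TensorProduct.induction_on with
    | zero => simp
    | add x y hx hy => simp only [map_add, hx, hy]
    | tmul a b => rfl
  have hD : ∀ (s : R) (h' : H) (u : H ⊗[k] H), f.toLinearMap.lTensor R
      (TensorProduct.map (orbitMap k H s) (LinearMap.mulRight k h') u) =
      TensorProduct.map (orbitMap k H s) (LinearMap.mulRight k (f h'))
        (f.toLinearMap.lTensor H u) := by
    intro s h' u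
    induction u using TensorProduct.induction_on with
    | zero => simp
    | add x y hx hy => simp only [map_add, hx, hy]
    | tmul a b => simp
  induction y using TensorProduct.induction_on with
  | zero => simp
  | add y y' hy hy' => simp only [map_add, LinearMap.add_apply, hy, hy']
  | tmul r h =>
    induction z using TensorProduct.induction_on with
    | zero => simp
    | add y y' hy hy' => simp only [map_add, hy, hy']
    | tmul s h' =>
      rw [mulMap_tmul_tmul, hL, hD, ← hf, LinearMap.lTensor_tmul, LinearMap.lTensor_tmul,
        mulMap_tmul_tmul]
      rfl

/-- A left comodule algebra endomorphism `f` of `H` induces the endomorphism `r # h ↦ r # f h`. -/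
def mapRight : SmashProduct k R H →+* SmashProduct k R H where
  toFun z := f.toLinearMap.lTensor R z
  map_one' := congrArg ((1 : R) ⊗ₜ[k] ·) (map_one f)
  map_zero' := map_zero (f.toLinearMap.lTensor R)
  map_add' := map_add (f.toLinearMap.lTensor R)
  map_mul' := lTensor_mulMap f hf

theorem mapRight_inl_mul_inr (r : R) (h : H) :
    mapRight f hf (inl k H r * inr k R h) = inl k H r * inr k R (f h) := by
  rw [inl_mul_inr, inl_mul_inr]
  rfl

end MapRight

end SmashProduct

/-! ### Character twists, and multiplication by `Λ` in the smash product -/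

namespace QLSDatum

open Boson SmashProduct

variable {k G : Type*} [Field k] [CommGroup G] {θ : ℕ} (D : QLSDatum k G θ)

/-- The automorphism `a ↦ ψ(a) a`, `xᵢ ↦ xᵢ` of `B(G, g, χ)` for a character `ψ` of `G`. -/
def twist (ψ : G →* kˣ) : D.Boson →ₐ[k] D.Boson :=
  lift D
    { toFun := fun a => (ψ a : k) • grp D a
      map_one' := by simp
      map_mul' := fun a b => by simp [smul_smul, mul_comm] }
    (x D)
    (fun a i => by simp [grp_mul_x, smul_smul, mul_comm])
    (x_pow D)
    (fun i j hij => x_mul_x D i j hij)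

@[simp] theorem twist_grp (ψ : G →* kˣ) (a : G) : twist D ψ (grp D a) = (ψ a : k) • grp D a := by
  simp [twist]

@[simp] theorem twist_x (ψ : G →* kˣ) (i : Fin θ) : twist D ψ (x D i) = x D i := by
  simp [twist]

theorem twist_word (ψ : G →* kˣ) (w : List (Fin θ)) : twist D ψ (word D w) = word D w := by
  induction w with
  | nil => simp
  | cons i w ih => rw [word_cons, map_mul, ih, twist_x]

theorem twist_one (b : D.Boson) : twist D 1 b = b := by
  have : twist D 1 = AlgHom.id k _ := by ext <;> simp
  rw [this, AlgHom.id_apply]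

theorem twist_mul (ψ ψ' : G →* kˣ) (b : D.Boson) :
    twist D (ψ * ψ') b = twist D ψ (twist D ψ' b) := by
  have : twist D (ψ * ψ') = (twist D ψ).comp (twist D ψ') := by
    ext <;> simp [smul_smul, mul_comm]
  rw [this, AlgHom.comp_apply]

theorem comul_twist (ψ : G →* kˣ) (b : D.Boson) : Coalgebra.comul (R := k) (twist D ψ b) =
    (twist D ψ).toLinearMap.lTensor D.Boson (Coalgebra.comul (R := k) b) := by
  have : (Bialgebra.comulAlgHom k D.Boson).comp (twist D ψ) =
      (Algebra.TensorProduct.map (AlgHom.id k _) (twist D ψ)).comp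
        (Bialgebra.comulAlgHom k D.Boson) := by
    ext <;> simp [comul_grp, comul_x]
  exact DFunLike.congr_fun this b

variable {R : Type*} [Ring R] [Algebra k R] [Module D.Boson R] [IsScalarTower k D.Boson R]
  [IsModuleAlgebra k R D.Boson]

variable (R) in
/-- The automorphism `r # h ↦ r # twist ψ h`. -/
def smashTwist (ψ : G →* kˣ) : SmashProduct k R D.Boson →+* SmashProduct k R D.Boson :=
  mapRight (twist D ψ) (comul_twist D ψ)

theorem smashTwist_inl_mul_inr (ψ : G →* kˣ) (r : R) (b : D.Boson) :
    smashTwist D R ψ (inl k _ r * inr k R b) = inl k _ r * inr k R (twist D ψ b) :=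
  mapRight_inl_mul_inr _ _ _ _

theorem smashTwist_one (z : SmashProduct k R D.Boson) : smashTwist D R 1 z = z := by
  induction z using add_induction with
  | h0 => simp
  | hadd y z hy hz => rw [map_add, hy, hz]
  | h r h => rw [smashTwist_inl_mul_inr, twist_one]

theorem smashTwist_mul (ψ ψ' : G →* kˣ) (z : SmashProduct k R D.Boson) :
    smashTwist D R (ψ * ψ') z = smashTwist D R ψ (smashTwist D R ψ' z) := by
  induction z using add_induction with
  | h0 => simp
  | hadd y z hy hz => rw [map_add, hy, hz, map_add, map_add]
  | h r h => rw [smashTwist_inl_mul_inr, smashTwist_inl_mul_inr, smashTwist_inl_mul_inr, twist_mul]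

theorem inr_grp_mul_inl (a : G) (r : R) : inr k R (grp D a) * inl k D.Boson r =
    inl k D.Boson (grp D a • r) * inr k R (grp D a) := by
  rw [inr_mul_inl, comul_grp, inl_mul_inr]
  rfl

theorem inr_x_mul_inl (i : Fin θ) (r : R) : inr k R (x D i) * inl k D.Boson r =
    inl k D.Boson (grp D (D.g i) • r) * inr k R (x D i) + inl k D.Boson (x D i • r) := by
  rw [inr_mul_inl, comul_x, inl_mul_inr, map_add]
  rfl

/-- The second term of the commutation rule ends in `xᵢ Λ = 0`. Thus left multiplication by `xᵢ` on
`R Λ` is the action of `xᵢ` on `R`. -/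
theorem inr_x_mul_inl_mul_top (i : Fin θ) (r : R) :
    inr k R (x D i) * (inl k D.Boson r * inr k R (top D)) =
      inl k D.Boson (x D i • r) * inr k R (top D) := by
  rw [← mul_assoc, inr_x_mul_inl, add_mul, mul_assoc, ← map_mul, x_mul_top, map_zero, mul_zero,
    zero_add]

theorem inr_word_mul_inl_mul_top (w : List (Fin θ)) (r : R) :
    inr k R (word D w) * (inl k D.Boson r * inr k R (top D)) =
      inl k D.Boson (word D w • r) * inr k R (top D) := by
  induction w with
  | nil => simp
  | cons i w ih =>
    rw [word_cons, map_mul, mul_assoc, ih, inr_x_mul_inl_mul_top, mul_smul]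

theorem inr_top_mul_inl_mul_top (r : R) :
    inr k R (top D) * (inl k D.Boson r * inr k R (top D)) =
      inl k D.Boson (top D • r) * inr k R (top D) :=
  inr_word_mul_inl_mul_top D _ r

theorem eq_zero_of_inl_mul_top {r : R} (h : inl k D.Boson r * inr k R (top D) = 0) : r = 0 := by
  rw [inl_mul_inr] at h
  -- Over a field some functional is nonzero at `Λ`; contracting with it recovers `r` up to a
  -- nonzero scalar.
  obtain ⟨f, hf⟩ : ∃ f : Module.Dual k D.Boson, f (top D) ≠ 0 := by
    by_contra! hne
    exact top_ne_zero D ((Module.forall_dual_apply_eq_zero_iff k _).1 hne)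
  have := congrArg (fun z : R ⊗[k] D.Boson => TensorProduct.rid k R (f.lTensor R z)) h
  have e : TensorProduct.rid k R (f.lTensor R (r ⊗ₜ top D)) = 0 := this.trans
    ((congrArg _ (map_zero (f.lTensor R))).trans (map_zero _))
  rw [LinearMap.lTensor_tmul, TensorProduct.rid_tmul] at e
  exact (smul_eq_zero_iff_right hf).1 e

theorem inr_word_mul_inl_of_left {w : List (Fin θ)} {c : R} (hc : ∀ i ∈ w, x D i • c = 0) :
    inr k R (word D w) * inl k D.Boson c =
      inl k D.Boson (grp D (wordDeg D w) • c) * inr k R (word D w) := by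
  induction w with
  | nil => simp [wordDeg]
  | cons i w ih =>
    rw [word_cons, map_mul, mul_assoc, ih fun j hj => hc j (List.mem_cons_of_mem _ hj), ← mul_assoc,
      inr_x_mul_inl, x_smul_grp_smul_eq_zero D _ (hc i List.mem_cons_self), map_zero, add_zero,
      mul_assoc, smul_smul, ← map_mul]
    rfl

end QLSDatum

end

/-! ### Ideals of the smash product -/

noncomputable section

namespace QLSDatum

open Boson SmashProduct

variable {k G : Type*} [Field k] [CommGroup G] {θ : ℕ} {D : QLSDatum k G θ}

variable {R : Type*} [Ring R] [Algebra k R] [Module D.Boson R] [IsScalarTower k D.Boson R]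
  [IsModuleAlgebra k R D.Boson]

theorem mul_mem_of_generators {N : AddSubgroup (SmashProduct k R D.Boson)}
    (hR : ∀ r, ∀ n ∈ N, inl k D.Boson r * n ∈ N) (hG : ∀ a, ∀ n ∈ N, inr k R (grp D a) * n ∈ N)
    (hx : ∀ i, ∀ n ∈ N, inr k R (x D i) * n ∈ N) (z : SmashProduct k R D.Boson) :
    ∀ n ∈ N, z * n ∈ N := by
  have hB : ∀ b : D.Boson, ∀ n ∈ N, inr k R b * n ∈ N := by
    intro b
    induction b using Boson.induction D with
    | hgrp a => exact hG a
    | hx i => exact hx i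
    | hc c =>
      intro n hn
      rw [Algebra.algebraMap_eq_smul_one, inr_smul, map_one, mul_one]
      exact hR _ n hn
    | hadd a b ha hb => intro n hn; rw [map_add, add_mul]; exact N.add_mem (ha n hn) (hb n hn)
    | hmul a b ha hb => intro n hn; rw [map_mul, mul_assoc]; exact ha _ (hb n hn)
  induction z using add_induction with
  | h0 => intro n _; rw [zero_mul]; exact N.zero_mem
  | hadd y z hy hz => intro n hn; rw [add_mul]; exact N.add_mem (hy n hn) (hz n hn)
  | h r b => intro n hn; rw [mul_assoc]; exact hR r _ (hB b n hn)

/-- The left ideal of `A` generated by `M Λ` lies in the span of the `r m Λ a` with `a ∈ G`, and `m'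
Λ r m Λ = m' (Λ · (r m)) Λ = 0`. Hence `(m Λ) A (m Λ) = 0`. -/
theorem eq_zero_of_isSemiprimeRing (hA : IsSemiprimeRing (SmashProduct k R D.Boson)) {M : Set R}
    (hg : ∀ a, ∀ m ∈ M, grp D a • m ∈ M) (hx : ∀ i, ∀ m ∈ M, x D i • m ∈ M)
    (hM : ∀ m ∈ M, ∀ r, ∀ m' ∈ M, m * (top D • (r * m')) = 0) : ∀ m ∈ M, m = 0 := by
  intro m hm
  set N : AddSubgroup (SmashProduct k R D.Boson) := AddSubgroup.closure
    {z | ∃ r, ∃ m ∈ M, ∃ a, z = inl k D.Boson (r * m) * inr k R (top D) * inr k R (grp D a)} with hN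
  have hgen : ∀ r, ∀ m ∈ M, ∀ a,
      inl k D.Boson (r * m) * inr k R (top D) * inr k R (grp D a) ∈ N :=
    fun r m hm a => AddSubgroup.subset_closure ⟨r, m, hm, a, rfl⟩
  have hlift : ∀ z : SmashProduct k R D.Boson, (∀ r, ∀ m ∈ M, ∀ a,
      z * (inl k D.Boson (r * m) * inr k R (top D) * inr k R (grp D a)) ∈ N) →
      ∀ n ∈ N, z * n ∈ N := by
    intro z hz n hn
    induction hn using AddSubgroup.closure_induction with
    | mem n hn =>
      obtain ⟨r, m, hm, a, rfl⟩ := hn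
      exact hz r m hm a
    | zero => rw [mul_zero]; exact N.zero_mem
    | add y y' _ _ hy hy' => rw [mul_add]; exact N.add_mem hy hy'
    | neg y _ hy => rw [mul_neg]; exact N.neg_mem hy
  have hmul : ∀ z, ∀ n ∈ N, z * n ∈ N := by
    refine mul_mem_of_generators (fun s => hlift _ fun r m hm a => ?_)
      (fun b => hlift _ fun r m hm a => ?_) (fun i => hlift _ fun r m hm a => ?_)
    · rw [← mul_assoc, ← mul_assoc, ← map_mul, ← mul_assoc]
      exact hgen _ m hm a
    -- Moving `b` past `Λ` costs a scalar and leaves `b` on the right, hence the factors from `G` in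
    -- the generators of `N`.
    · obtain ⟨c, -, hc⟩ := grp_mul_word D b (topWord D)
      rw [← top] at hc
      have : inr k R (grp D b) * (inl k D.Boson (r * m) * inr k R (top D) * inr k R (grp D a)) =
          inl k D.Boson ((algebraMap k R c * (grp D b • r)) * (grp D b • m)) * inr k R (top D) *
            inr k R (grp D (b * a)) := by
        rw [← mul_assoc, ← mul_assoc, inr_grp_mul_inl, mul_assoc (inl k D.Boson _), ← map_mul, hc,
          inr_smul, grp_smul_mul, mul_assoc (algebraMap k R c), Algebra.commutes,
          map_mul (inl k D.Boson) _ (algebraMap k R c), map_mul (inr k R), map_mul (grp D),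
          map_mul (inr k R)]
        simp only [mul_assoc]
      rw [this]
      exact hgen _ _ (hg b m hm) _
    · rw [← mul_assoc, inr_x_mul_inl_mul_top, x_smul_mul, map_add, add_mul, add_mul]
      exact N.add_mem (hgen _ _ (hx i m hm) a) (hgen _ m hm a)
  have hzero : ∀ n ∈ N, inl k D.Boson m * inr k R (top D) * n = 0 := by
    intro n hn
    induction hn using AddSubgroup.closure_induction with
    | mem n hn =>
      obtain ⟨r, m', hm', a, rfl⟩ := hn
      rw [mul_assoc, ← mul_assoc (inr k R (top D)), inr_top_mul_inl_mul_top, ← mul_assoc,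
        ← mul_assoc, ← map_mul, hM m hm r m' hm', map_zero, zero_mul, zero_mul]
    | zero => rw [mul_zero]
    | add y y' _ _ hy hy' => rw [mul_add, hy, hy', add_zero]
    | neg y _ hy => rw [mul_neg, hy, neg_zero]
  apply eq_zero_of_inl_mul_top D
  refine hA.eq_zero_of_mul_mul fun b => ?_
  rw [mul_assoc]
  refine hzero _ (hmul b _ ?_)
  have := hgen 1 m hm 1
  rwa [one_mul, map_one, map_one, mul_one] at this

variable (D R) in
/-- The component of degree `a` of `R # B` with respect to the action of the characters of `G`. -/
def component (a : G) : AddSubgroup (SmashProduct k R D.Boson) := AddSubgroup.closure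
  {z | ∃ r w, z = inl k D.Boson r * inr k R (word D w * grp D a)}

theorem exists_sum_component [Fintype G] (z : SmashProduct k R D.Boson) :
    ∃ f : G → SmashProduct k R D.Boson, (∀ a, f a ∈ component D R a) ∧ ∑ a, f a = z := by
  classical
  induction z using add_induction with
  | h0 => exact ⟨0, fun a => zero_mem _, by simp⟩
  | hadd y z hy hz =>
    obtain ⟨f, hf, rfl⟩ := hy
    obtain ⟨f', hf', rfl⟩ := hz
    exact ⟨f + f', fun a => add_mem (hf a) (hf' a), Finset.sum_add_distrib⟩
  | h r b =>
    have hb : b ∈ Submodule.span k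
        (Set.range fun p : List (Fin θ) × G => word D p.1 * grp D p.2) := by
      rw [span_word_mul_grp]; trivial
    induction hb using Submodule.span_induction generalizing r with
    | mem b hb =>
      obtain ⟨⟨w, a⟩, rfl⟩ := hb
      refine ⟨Pi.single a (inl k D.Boson r * inr k R (word D w * grp D a)), fun c => ?_, by simp⟩
      rcases eq_or_ne c a with rfl | hca
      · rw [Pi.single_eq_same]
        exact AddSubgroup.subset_closure ⟨r, w, rfl⟩
      · rw [Pi.single_eq_of_ne hca]
        exact zero_mem _
    | zero => exact ⟨0, fun a => zero_mem _, by simp⟩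
    | add b b' _ _ hb hb' =>
      obtain ⟨f, hf, h⟩ := hb r
      obtain ⟨f', hf', h'⟩ := hb' r
      exact ⟨f + f', fun a => add_mem (hf a) (hf' a), by
        rw [map_add, mul_add, ← h, ← h']; exact Finset.sum_add_distrib⟩
    | smul c b _ hb =>
      obtain ⟨f, hf, h⟩ := hb (r * algebraMap k R c)
      exact ⟨f, hf, by rw [h, inr_smul, map_mul, mul_assoc]⟩

theorem smashTwist_of_mem_component (ψ : G →* kˣ) {a : G} {z : SmashProduct k R D.Boson}
    (hz : z ∈ component D R a) :
    smashTwist D R ψ z = inl k D.Boson (algebraMap k R (ψ a)) * z := by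
  induction hz using AddSubgroup.closure_induction with
  | mem z hz =>
    obtain ⟨r, w, rfl⟩ := hz
    rw [smashTwist_inl_mul_inr, map_mul, twist_word, twist_grp, mul_smul_comm, inr_smul,
      ← mul_assoc, ← mul_assoc, ← map_mul, ← map_mul, Algebra.commutes]
  | zero => simp
  | add y y' _ _ hy hy' => rw [map_add, hy, hy', mul_add]
  | neg y _ hy => rw [map_neg, hy, mul_neg]

/-- Fourier inversion: averaging the twists of the sum against the character values at `a⁻¹`
isolates the component of degree `a`. The number of characters is invertible in characteristic zero.
-/
theorem component_mem_of_twist_mem [IsAlgClosed k] [CharZero k] [Fintype G]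
    {I : Ideal (SmashProduct k R D.Boson)} (hI : ∀ ψ, ∀ z ∈ I, smashTwist D R ψ z ∈ I)
    {f : G → SmashProduct k R D.Boson} (hf : ∀ a, f a ∈ component D R a) (h : ∑ a, f a ∈ I)
    (a : G) : f a ∈ I := by
  have := finite_characters (k := k) (G := G)
  have := Fintype.ofFinite (G →* kˣ)
  have hsum : ∑ ψ : G →* kˣ, inl k D.Boson (algebraMap k R (ψ a⁻¹)) *
      smashTwist D R ψ (∑ b, f b) =
      inl k D.Boson (algebraMap k R (Fintype.card (G →* kˣ))) * f a := by
    simp only [map_sum, smashTwist_of_mem_component _ (hf _), Finset.mul_sum, ← mul_assoc,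
      ← map_mul, ← Units.val_mul]
    rw [Finset.sum_comm]
    simp only [← Finset.sum_mul, ← map_sum]
    rw [Finset.sum_eq_single_of_mem a (Finset.mem_univ a)]
    · simp
    · intro b _ hb
      rw [sum_characters_eq_zero (k := k) (g := a⁻¹ * b) (by rwa [Ne, inv_mul_eq_one, eq_comm]),
        map_zero, map_zero, zero_mul]
  have hmem := I.sum_mem (t := Finset.univ) (f := fun ψ : G →* kˣ =>
    inl k D.Boson (algebraMap k R (ψ a⁻¹)) * smashTwist D R ψ (∑ b, f b))
    fun ψ _ => I.mul_mem_left _ (hI ψ _ h)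
  rw [hsum] at hmem
  have := I.mul_mem_left (inl k D.Boson (algebraMap k R (Fintype.card (G →* kˣ) : k)⁻¹)) hmem
  rwa [← mul_assoc, ← map_mul, ← map_mul, inv_mul_cancel₀
    (Nat.cast_ne_zero.2 Fintype.card_ne_zero), map_one, map_one, one_mul] at this

theorem mul_inr_grp_inv_mem_component {a : G} {z : SmashProduct k R D.Boson}
    (hz : z ∈ component D R a) : z * inr k R (grp D a⁻¹) ∈ component D R 1 := by
  induction hz using AddSubgroup.closure_induction with
  | mem y hy =>
    obtain ⟨r, w, rfl⟩ := hy
    refine AddSubgroup.subset_closure ⟨r, w, ?_⟩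
    rw [mul_assoc, ← map_mul, mul_assoc, ← map_mul, mul_inv_cancel]
  | zero => rw [zero_mul]; exact zero_mem _
  | add y y' _ _ hy hy' => rw [add_mul]; exact add_mem hy hy'
  | neg y _ hy => rw [neg_mul]; exact neg_mem hy

variable (D R) in
/-- The map `(r_s)_s ↦ ∑ r_s x^s`, indexed by multisets of indices. -/
def sumWords : (Multiset (Fin θ) →₀ R) →+ SmashProduct k R D.Boson :=
  Finsupp.liftAddHom fun s =>
    (AddMonoidHom.mulRight (inr k R (word D s.toList))).comp (inl k D.Boson).toAddMonoidHom

theorem sumWords_apply (F : Multiset (Fin θ) →₀ R) : sumWords D R F =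
    ∑ s ∈ F.support, inl k D.Boson (F s) * inr k R (word D s.toList) := rfl

theorem mem_range_sumWords {z : SmashProduct k R D.Boson} (hz : z ∈ component D R 1) :
    z ∈ (sumWords D R).range := by
  refine (AddSubgroup.closure_le _).2 ?_ hz
  rintro _ ⟨r, w, rfl⟩
  obtain ⟨c, -, hc⟩ := exists_smul_word_of_perm D
    (Multiset.coe_eq_coe.1 (Multiset.coe_toList (w : Multiset (Fin θ)))).symm
  refine ⟨Finsupp.single (w : Multiset (Fin θ)) (r * algebraMap k R c), ?_⟩
  rw [map_one, mul_one, hc, inr_smul, ← mul_assoc, ← map_mul]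
  exact Finsupp.liftAddHom_apply_single _ _ _

/-- Take a nonvanishing monomial of least degree occurring in `z` and multiply on the right by its
complement in `Λ`: every other monomial then vanishes. -/
theorem exists_mul_word_eq_top {z : SmashProduct k R D.Boson} (hz : z ∈ component D R 1)
    (h0 : z ≠ 0) : ∃ w r, r ≠ 0 ∧ z * inr k R (word D w) = inl k D.Boson r * inr k R (top D) := by
  classical
  obtain ⟨F, rfl⟩ := mem_range_sumWords hz
  rw [sumWords_apply] at h0 ⊢
  set S := F.support.filter fun s => word D s.toList ≠ 0
  have hS : S.Nonempty := by
    by_contra hne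
    rw [Finset.not_nonempty_iff_eq_empty, Finset.filter_eq_empty_iff] at hne
    refine h0 (Finset.sum_eq_zero fun s hs => ?_)
    rw [not_not.1 (hne hs), map_zero, mul_zero]
  obtain ⟨s, hs, hmin⟩ := S.exists_min_image Multiset.card hS
  obtain ⟨hs1, hs2⟩ := Finset.mem_filter.1 hs
  have hcount : ∀ (s : Multiset (Fin θ)) i, s.toList.count i = s.count i := fun s i => by
    rw [← Multiset.coe_count, Multiset.coe_toList]
  have hle : ∀ i, s.count i ≤ (topWord D).count i := fun i => by
    rw [← hcount]; exact word_ne_zero_imp D hs2 i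
  set t : Multiset (Fin θ) := (topWord D : Multiset (Fin θ)) - s
  have ht : ∀ i, t.toList.count i = (topWord D).count i - s.count i := fun i => by
    rw [hcount, Multiset.count_sub, Multiset.coe_count]
  obtain ⟨c, hc0, hc⟩ := exists_smul_word_of_perm D (v := s.toList ++ t.toList) (w := topWord D) (by
    rw [List.perm_iff_count]
    intro i
    rw [List.count_append, ht, hcount, Nat.add_sub_cancel' (hle i)])
  refine ⟨t.toList, c • F s, smul_ne_zero hc0 (Finsupp.mem_support_iff.1 hs1), ?_⟩
  rw [Finset.sum_mul, Finset.sum_eq_single_of_mem s hs1]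
  · rw [mul_assoc, ← map_mul, ← word_append, hc, inr_smul, ← mul_assoc, ← map_mul,
      ← Algebra.commutes, ← Algebra.smul_def, ← top]
  · intro s' hs' hne
    rw [mul_assoc, ← map_mul, ← word_append]
    by_contra hne0
    have h1 : word D (s'.toList ++ t.toList) ≠ 0 := fun h => hne0 (by rw [h, map_zero, mul_zero])
    have h2 : word D s'.toList ≠ 0 := fun h => h1 (by rw [word_append, h, zero_mul])
    -- If `s' + t` still fits into `Λ = s + t`, then `s' ≤ s`; minimality of the degree of `s`
    -- leaves only `s' = s`.
    refine hne (Multiset.eq_of_le_of_card_le (Multiset.le_iff_count.2 fun i => ?_)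
      (hmin s' (Finset.mem_filter.2 ⟨hs', h2⟩)))
    have := word_ne_zero_imp D h1 i
    rw [List.count_append, ht, hcount] at this
    have := hle i
    omega

/-- `L` consists of the `l` with `l Λ ∈ I`, for a square-zero ideal `I` stable under the character
twists. Stability is what makes `L` nonzero: it puts homogeneous components into `I`, and these can
be pushed to `R Λ`. -/
theorem exists_leftIdeal_of_not_isSemiprimeRing [IsAlgClosed k] [CharZero k] [Finite G]
    (hA : ¬ IsSemiprimeRing (SmashProduct k R D.Boson)) :
    ∃ L : Ideal R, L ≠ ⊥ ∧ (∀ a, ∀ l ∈ L, grp D a • l ∈ L) ∧ (∀ i, ∀ l ∈ L, x D i • l ∈ L) ∧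
      (∀ c : R, (∀ i, x D i • c = 0) → ∀ l ∈ L, l * c ∈ L) ∧
      ∀ l ∈ L, ∀ l' ∈ L, l * (top D • l') = 0 := by
  have := Fintype.ofFinite G
  have := finite_characters (k := k) (G := G)
  obtain ⟨I, hIT, hI0, hIφ, hI⟩ := exists_invariant_sq_zero_ideal hA
    (Γ := G →* kˣ) (smashTwist D R) (fun z => by rw [smashTwist_one])
    (fun ψ ψ' z => by rw [smashTwist_mul])
  refine ⟨{ carrier := {l | inl k D.Boson l * inr k R (top D) ∈ I}
            add_mem' := fun {l l'} hl hl' => by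
              rw [Set.mem_ofPred_eq, map_add, add_mul]; exact I.add_mem hl hl'
            zero_mem' := by rw [Set.mem_ofPred_eq, map_zero, zero_mul]; exact I.zero_mem
            smul_mem' := fun r l hl => by
              rw [Set.mem_ofPred_eq, smul_eq_mul, map_mul, mul_assoc]
              exact I.mul_mem_left _ hl }, ?_, ?_, ?_, ?_, ?_⟩
  · intro hL
    obtain ⟨z, hz, hz0⟩ := Submodule.exists_mem_ne_zero_of_ne_bot hI0
    obtain ⟨f, hf, rfl⟩ := exists_sum_component z
    have hfI := component_mem_of_twist_mem hIφ hf hz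
    obtain ⟨a, ha⟩ : ∃ a, f a ≠ 0 := by
      by_contra! h
      exact hz0 (Finset.sum_eq_zero fun a _ => h a)
    obtain ⟨w, r, hr, hw⟩ := exists_mul_word_eq_top
      (mul_inr_grp_inv_mem_component (hf a)) fun h => ha (by
      have := congrArg (· * inr k R (grp D a)) h
      simpa only [mul_assoc, ← map_mul, inv_mul_cancel, map_one, mul_one, zero_mul] using this)
    have hrI : inl k D.Boson r * inr k R (top D) ∈ I := by
      rw [← hw]
      exact I.mul_mem_right _ (I.mul_mem_right _ (hfI a))
    have : r ∈ (⊥ : Ideal R) := by rw [← hL]; exact hrI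
    exact hr this
  · intro a l hl
    obtain ⟨c, hc0, hc⟩ := grp_mul_word D a (topWord D)
    have e : top D = grp D a * top D * (c⁻¹ • grp D a⁻¹) := by
      rw [top, hc, smul_mul_smul_comm, mul_inv_cancel₀ hc0, one_smul, mul_assoc, ← map_mul,
        mul_inv_cancel, map_one, mul_one]
    change inl k D.Boson (grp D a • l) * inr k R (top D) ∈ I
    rw [e, map_mul, map_mul, ← mul_assoc, ← mul_assoc, ← inr_grp_mul_inl, mul_assoc (inr k R _)]
    exact I.mul_mem_right _ (I.mul_mem_left _ hl)
  · intro i l hl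
    change inl k D.Boson (x D i • l) * inr k R (top D) ∈ I
    rw [← inr_x_mul_inl_mul_top]
    exact I.mul_mem_left _ hl
  · intro c hc l hl
    -- `c` is untwisted beforehand by the degree of `Λ`, so that `c Λ = Λ c'` and right
    -- multiplication in `I` applies.
    have e := inr_word_mul_inl_of_left D (w := topWord D)
      (c := grp D (wordDeg D (topWord D))⁻¹ • c) fun i _ => x_smul_grp_smul_eq_zero D _ (hc i)
    rw [grp_smul_grp_inv_smul] at e
    change inl k D.Boson (l * c) * inr k R (top D) ∈ I
    rw [map_mul, mul_assoc, top, ← e, ← mul_assoc]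
    exact I.mul_mem_right _ hl
  · intro l hl l' hl'
    apply eq_zero_of_inl_mul_top D
    rw [map_mul, mul_assoc, ← inr_top_mul_inl_mul_top, ← mul_assoc]
    exact hI _ hl _ hl'

theorem isSemiprimeRing_of_noKilledIdeals [IsAlgClosed k] [CharZero k] [Finite G]
    (hC : SemiprimeInvariants D R) {σ : Equiv.Perm (Fin θ)} (hσ : NoKilledIdeals D R σ) :
    IsSemiprimeRing (SmashProduct k R D.Boson) := by
  by_contra hA
  obtain ⟨L, hL0, hLg, hLx, hLC, hL⟩ := exists_leftIdeal_of_not_isSemiprimeRing hA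
  have hLw : ∀ w, ∀ l ∈ L, word D w • l ∈ L := by
    intro w l hl
    induction w with
    | nil => simpa using hl
    | cons i w ih => rw [word_cons, mul_smul]; exact hLx i _ ih
  have htop : ∀ r : R, ∀ i, x D i • top D • r = 0 := fun r i => by
    rw [smul_smul, x_mul_top, zero_smul]
  -- `Λ · l` is invariant, and `(Λ · l) d` is again in `L`, so `(Λ · l) d (Λ · l)` lies in `L (Λ ·
  -- L) = 0`.
  have hLtop : ∀ l ∈ L, top D • l = 0 := fun l hl =>
    hC _ (htop l) fun d hd => hL _ (hLC d hd _ (hLw _ l hl)) l hl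
  have hJ : IsInvariantIdeal D {j : R | j ∈ L ∧ ∀ i, x D i • j = 0} :=
    { x_smul := fun j hj => hj.2
      mul_mem := fun c hc j hj =>
        ⟨L.mul_mem_left c hj.1, fun i => x_smul_mul_eq_zero (hc i) (hj.2 i)⟩
      mul_mem_right := fun c hc j hj =>
        ⟨hLC c hc j hj.1, fun i => x_smul_mul_eq_zero (hj.2 i) (hc i)⟩
      grp_smul := fun a j hj =>
        ⟨hLg a j hj.1, fun i => x_smul_grp_smul_eq_zero D a (hj.2 i)⟩ }
  have hJ0 := eq_zero_of_top_smul_mul hC hJ hσ fun r j hj => by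
    rw [top, ← word_smul_mul_of_right D fun i _ => hj.2 i]
    exact hLtop _ (L.mul_mem_left r hj.1)
  refine hL0 (eq_bot_iff.2 fun l hl => ?_)
  exact x_induction D (U := (L : Set R)) (P := fun l => l = 0) hLx rfl
    (fun u hu h => hJ0 u ⟨hu, h⟩) hl

/-- The elements `m'` violating the condition form a set `M` stable under `G` and the `xᵢ`. Up to a
scalar `Λ` factors as a monomial times `x_{σ i}` times the tail of later letters. The tail passes
over `m'`, giving an element of the left ideal generated by `m'`, which `x_{σ i}` kills. -/
theorem noKilledIdeals_of_isSemiprimeRing (hA : IsSemiprimeRing (SmashProduct k R D.Boson))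
    (σ : Equiv.Perm (Fin θ)) : NoKilledIdeals D R σ := by
  intro i z hz hzs
  refine eq_zero_of_isSemiprimeRing hA (M := {z | (∀ l, i < l → x D (σ l) • z = 0) ∧
    ∀ s : R, (∀ l, i < l → x D (σ l) • s = 0) → x D (σ i) • (s * z) = 0}) ?_ ?_ ?_ z ⟨hz, hzs⟩
  · rintro a m ⟨hm, hms⟩
    refine ⟨fun l hl => x_smul_grp_smul_eq_zero D a (hm l hl), fun s hs => ?_⟩
    rw [← grp_smul_grp_inv_smul D a s, ← grp_smul_mul]
    exact x_smul_grp_smul_eq_zero D a (hms _ fun l hl => x_smul_grp_smul_eq_zero D _ (hs l hl))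
  · rintro p m ⟨hm, hms⟩
    refine ⟨fun l hl => x_smul_x_smul_eq_zero D p (hm l hl), fun s hs => ?_⟩
    have hs' : ∀ l, i < l → x D (σ l) • grp D (D.g p)⁻¹ • s = 0 :=
      fun l hl => x_smul_grp_smul_eq_zero D _ (hs l hl)
    -- Replacing `s` by `g_p⁻¹ · s` makes the Leibniz rule express `s (x_p · m)` as a difference of
    -- two terms killed by `x_{σ i}`.
    have e := x_smul_mul D p (grp D (D.g p)⁻¹ • s) m
    rw [grp_smul_grp_inv_smul] at e
    rw [← sub_eq_iff_eq_add.2 e, smul_sub, x_smul_x_smul_eq_zero D p (hms _ hs'),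
      hms _ fun l hl => x_smul_x_smul_eq_zero D p (hs' l hl), sub_zero]
  · rintro m - r m' ⟨hm', hms'⟩
    set v : List (Fin θ) := σ i :: tailWord D σ (i + 1)
    have hv : ∀ l ∈ v, v.count l ≤ (topWord D).count l := by
      intro l _
      obtain ⟨l, rfl⟩ := σ.surjective l
      have hm : 2 ≤ D.m (σ l) := D.two_le_orderOf (σ l)
      rw [List.count_cons, count_tailWord, count_topWord]
      rcases eq_or_ne i l with rfl | hil
      · simp; omega
      · have : (σ i == σ l) = false := by simpa using hil
        rw [this]
        split_ifs <;> first | omega | contradiction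
    obtain ⟨c, -, hc⟩ := exists_smul_word_of_perm D
      ((List.perm_append_comm.trans (List.subperm_append_diff_self_of_count_le hv)).symm)
    have htail : ∀ l, i < l → x D (σ l) • word D (tailWord D σ (i + 1)) • r = 0 := fun l hl => by
      rw [smul_smul, x_mul_tailWord σ (show (i : ℕ) + 1 ≤ l from hl), zero_smul]
    rw [top, hc, smul_assoc, word_append, word_cons, mul_smul, mul_smul,
      word_smul_mul_of_right D (fun l hl => ?_), hms' _ htail, smul_zero, smul_zero, mul_zero]
    obtain ⟨l', hl', rfl⟩ := le_of_mem_tailWord hl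
    exact hm' l' hl'

/-! ### From elements to subalgebras and left ideals -/

variable (D R) in
theorem mem_iInf_xKernel (σ : Equiv.Perm (Fin θ)) {r : R} :
    r ∈ ⨅ i : Fin θ, D.xKernel R (σ i) ↔ ∀ i, x D i • r = 0 := by
  rw [Algebra.mem_iInf]
  refine ⟨fun h i => ?_, fun h i => h (σ i)⟩
  have := h (σ.symm i)
  rwa [Equiv.apply_symm_apply] at this

variable (D R) in
theorem mem_iInf_iInf_xKernel (σ : Equiv.Perm (Fin θ)) (i : Fin θ) {r : R} :
    r ∈ ⨅ (j : Fin θ) (_ : i < j), D.xKernel R (σ j) ↔ ∀ j, i < j → x D (σ j) • r = 0 := by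
  simp only [Algebra.mem_iInf]
  rfl

theorem semiprimeInvariants_of_isSemiprimeRing {σ : Equiv.Perm (Fin θ)}
    (h : IsSemiprimeRing ↥(⨅ i : Fin θ, D.xKernel R (σ i))) : SemiprimeInvariants D R := by
  intro c hc hcd
  have := h.eq_zero_of_mul_mul (a := ⟨c, (mem_iInf_xKernel D R σ).2 hc⟩) fun d =>
    Subtype.ext (hcd d ((mem_iInf_xKernel D R σ).1 d.2))
  exact congrArg Subtype.val this

/-- A `G`-stable square-zero ideal `I` of `C` serves as `M`: the `xᵢ` act on it by zero, and `Λ · (r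
d) = (Λ · r) d` stays in `I` because `Λ · r ∈ C`. -/
theorem isSemiprimeRing_iInf_xKernel [Finite G]
    (hA : IsSemiprimeRing (SmashProduct k R D.Boson)) (σ : Equiv.Perm (Fin θ)) :
    IsSemiprimeRing ↥(⨅ i : Fin θ, D.xKernel R (σ i)) := by
  by_contra hC
  obtain ⟨I, hIT, hI0, hIφ, hI⟩ := exists_invariant_sq_zero_ideal hC (Γ := G)
    (fun a =>
      { toFun := fun c => ⟨grp D a • (c : R), (mem_iInf_xKernel D R σ).2 fun i =>
          x_smul_grp_smul_eq_zero D a ((mem_iInf_xKernel D R σ).1 c.2 i)⟩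
        map_one' := Subtype.ext (by
          simp [IsModuleAlgebra.smul_one' (k := k) (R := R), counit_grp])
        map_zero' := Subtype.ext (smul_zero _)
        map_add' := fun c d => Subtype.ext (smul_add _ _ _)
        map_mul' := fun c d => Subtype.ext (grp_smul_mul D a _ _) })
    (fun c => Subtype.ext (by simp)) (fun a b c => Subtype.ext (by simp [mul_smul]))
  obtain ⟨z, hz, hz0⟩ := Submodule.exists_mem_ne_zero_of_ne_bot hI0
  refine hz0 (Subtype.ext (eq_zero_of_isSemiprimeRing hA (M := Subtype.val '' (I : Set _))
    ?_ ?_ ?_ _ ⟨z, hz, rfl⟩))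
  · rintro a _ ⟨c, hc, rfl⟩
    exact ⟨_, hIφ a c hc, rfl⟩
  · rintro i _ ⟨c, _, rfl⟩
    exact ⟨0, I.zero_mem, ((mem_iInf_xKernel D R σ).1 c.2 i).symm⟩
  · rintro _ ⟨c, hc, rfl⟩ r _ ⟨d, hd, rfl⟩
    rw [top, word_smul_mul_of_right D fun i _ => (mem_iInf_xKernel D R σ).1 d.2 i, ← top]
    exact congrArg Subtype.val (hI c hc _ (I.mul_mem_left ⟨top D • r, (mem_iInf_xKernel D R σ).2
      fun i => by rw [smul_smul, x_mul_top, zero_smul]⟩ hd))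

/-- The conditions on left ideals in elementwise form. -/
theorem noKilledIdeals_iff (σ : Equiv.Perm (Fin θ)) : NoKilledIdeals D R σ ↔
    (∀ i : Fin θ, (i : ℕ) + 1 = θ →
      ∀ L : Ideal R, L ≠ ⊥ → ∃ r ∈ L, x D (σ i) • r ≠ 0) ∧
    (∀ i : Fin θ, (i : ℕ) + 1 < θ →
      ∀ L : Ideal ↥(⨅ (j : Fin θ) (_ : i < j), D.xKernel R (σ j)), L ≠ ⊥ →
        ∃ r ∈ L, x D (σ i) • (r : R) ≠ 0) := by
  constructor
  · refine fun h => ⟨fun i hi L hL => ?_, fun i _ L hL => ?_⟩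
    · by_contra! hx
      refine hL (eq_bot_iff.2 fun z hz => h i z (fun l hl => ?_) fun s _ => hx _ (L.mul_mem_left s hz))
      exact absurd l.2 (by have : (i : ℕ) < l := hl; omega)
    · by_contra! hx
      refine hL (eq_bot_iff.2 fun z hz => Subtype.ext (h i z ((mem_iInf_iInf_xKernel D R σ i).1 z.2)
        fun s hs => hx _ (L.mul_mem_left ⟨s, (mem_iInf_iInf_xKernel D R σ i).2 hs⟩ hz)))
  · rintro ⟨h2, h3⟩ i z hz hzs
    by_contra hz0
    -- For the last index no later letter exists, so the ambient algebra is `R` itself. In both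
    -- cases the principal left ideal of `z` is tested.
    rcases (show (i : ℕ) + 1 ≤ θ from i.2).eq_or_lt with hi | hi
    · obtain ⟨r, hr, hxr⟩ := h2 i hi (Ideal.span {z}) (by simpa using hz0)
      obtain ⟨s, rfl⟩ := Ideal.mem_span_singleton'.1 hr
      exact hxr (hzs s fun l hl => absurd l.2 (by have : (i : ℕ) < l := hl; omega))
    · obtain ⟨r, hr, hxr⟩ := h3 i hi (Ideal.span {⟨z, (mem_iInf_iInf_xKernel D R σ i).2 hz⟩})
        (fun h => hz0 (congrArg Subtype.val (Ideal.span_singleton_eq_bot.1 h)))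
      obtain ⟨s, rfl⟩ := Ideal.mem_span_singleton'.1 hr
      exact hxr (hzs s ((mem_iInf_iInf_xKernel D R σ i).1 s.2))

end QLSDatum

end

theorem theorem2p5 {k : Type*} [Field k] [IsAlgClosed k] [CharZero k]
    {G : Type*} [CommGroup G] [Finite G] {θ : ℕ} (D : QLSDatum k G θ)
    (R : Type*) [Ring R] [Algebra k R] [Module D.Boson R] [IsScalarTower k D.Boson R]
    [IsModuleAlgebra k R D.Boson] :
    IsSemiprimeRing (SmashProduct k R D.Boson) ↔
      ∃ σ : Equiv.Perm (Fin θ),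
        IsSemiprimeRing ↥(⨅ i : Fin θ, D.xKernel R (σ i)) ∧
        (∀ i : Fin θ, (i : ℕ) + 1 = θ →
          ∀ L : Ideal R, L ≠ ⊥ → ∃ r ∈ L, QLSDatum.Boson.x D (σ i) • r ≠ 0) ∧
        (∀ i : Fin θ, (i : ℕ) + 1 < θ →
          ∀ L : Ideal ↥(⨅ (j : Fin θ) (_ : i < j), D.xKernel R (σ j)), L ≠ ⊥ →
            ∃ r ∈ L, QLSDatum.Boson.x D (σ i) • (r : R) ≠ 0) := by
  constructor
  · intro hA
    -- Every ordering would do here; the given one is taken.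
    exact ⟨1, QLSDatum.isSemiprimeRing_iInf_xKernel hA 1,
      (QLSDatum.noKilledIdeals_iff 1).1 (QLSDatum.noKilledIdeals_of_isSemiprimeRing hA 1)⟩
  · rintro ⟨σ, h1, h⟩
    exact QLSDatum.isSemiprimeRing_of_noKilledIdeals
      (QLSDatum.semiprimeInvariants_of_isSemiprimeRing h1) ((QLSDatum.noKilledIdeals_iff σ).2 h)
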